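/- Let $n\ge 1$, let $B$ be the open unit ball in $\mathbb R^n$, let $\omega_n$ be the surface area of its boundary (so $\omega_1=2$), let $\nu(x)=x$ be the outward unit normal on $\partial B$, and let $D\in\mathbb R^n$. Let $\Phi$ be the fundamental solution of the Laplacian: $\Phi(x)=\frac{1}{\omega_1}|x|$ if $n=1$, $\Phi(x)=\frac1{\omega_2}\log|x|$ if $n=2$, and $\Phi(x)=-\frac1{(n-2)\omega_n|x|^{n-2}}$ if $n>2$. For $z\in B$ put $$G_z^{\mathrm{Poisson}}(x)=\Phi(x-z)+\frac1{\omega_n}\int_0^{|z|}\left(\frac{x\cdot\frac z{|z|}-\frac1s}{\left|sx-\frac z{|z|}\right|^n}+\frac1s\right)ds-\frac1{2\omega_n}|x|^2$$ (for $z=0$ the integral is $0$). For $z\in B\setminus\{0\}$ put $$G_z^{D}(x)=\frac D{\omega_n}\cdot\Bigg(\frac{x-z}{|x-z|^n}-\frac{x\cdot z-1}{\left||z|x-\frac z{|z|}\right|^n}\frac z{|z|^2}-\frac z{|z|^2}-\int_0^{|z|}\left(\frac1{\left|sx-\frac z{|z|}\right|^n}+n\,\frac{s\,x\cdot\frac z{|z|}-1}{\left|sx-\frac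 z{|z|}\right|^{n+2}}\right)ds\,\left(I-\frac z{|z|}\otimes\frac z{|z|}\right)\frac x{|z|}\Bigg),$$ and put $G_0^{D}(x)=\frac D{\omega_n}\cdot\left(\frac x{|x|^n}+(n-1)x\right)$. Then the following hold. 1. For every $z\in B$, the solutions of $$\Delta u=\operatorname{div}(D\delta_z)\ \text{ in }B,\qquad \nabla u\cdot\nu=0\ \text{ on }\partial B$$ are exactly the functions $G_z^{D}$ plus a constant (which may depend on $z$). That is, a function $u$ is a solution if and only if there is a constant $C$ with $u=G_z^{D}+C$ on $\overline B\setminus\{z\}$. Here a solution is a real function $u$ that is locally integrable on $B$, satisfies $\int_B u\,\Delta\varphi\,dx=-D\cdot\nabla\varphi(z)$ for all $\varphi\in C_c^\infty(B)$, is $C^1$ on $\overline B\setminus\{z\}$ (up to the boundary), and satisfies $\nabla u\cdot\nu=0$ at every point of $\partial B$. 2. For every $z\in B$ and $x\in\overline B\setminus\{z\}$, the function $w\mapsto G_w^{\mathrm{Poisson}}(x)$ is differentiable at $z$, and $G_z^{D}(x)=-D\cdot\nabla_zG_z^{\mathrm{Poisson}}(x)$. 3. For every $z\in B\setminus\{0\}$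 and $x\in\overline B\setminus\{0,z\}$, with $z^*=z/|z|^2$, $$G_z^{D}(x)=\frac D{\omega_n}\cdot\Bigg(\frac{x-z}{|x-z|^n}-\frac{x\cdot z-1}{|z|^n|x-z^*|^n}z^*-z^*-\Bigg[\frac{x\cdot\frac z{|z|}}{|x|^2}\left(1-\frac1{|z|^n|x-z^*|^n}\right)+\int_0^{|z|}\frac{ds}{\left|sx-\frac z{|z|}\right|^n}+n\left(\left(\frac x{|x|}\cdot\frac z{|z|}\right)^2-1\right)\int_0^{|z|}\frac{ds}{\left|sx-\frac z{|z|}\right|^{n+2}}\Bigg]\left(I-\frac z{|z|}\otimes\frac z{|z|}\right)\frac x{|z|}\Bigg).$$ 4. For every $x\in\overline B\setminus\{0\}$, $G_z^{D}(x)\to G_0^{D}(x)$ as $z\to0$, $z\ne0$. -/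

import Mathlib

open MeasureTheory Filter Topology Metric Set
open scoped ContDiff RealInnerProductSpace Laplacian Gradient

namespace EEGGreen

noncomputable section

/-- The surface area `ω_n` of the unit sphere of `ℝⁿ` (so `ω_1 = 2`). -/
def surfaceArea (n : ℕ) : ℝ :=
  (volume : Measure (EuclideanSpace ℝ (Fin n))).toSphere.real univ

/-- The fundamental solution `Φ` of the Laplace operator on `ℝⁿ`, `n ≥ 1`. -/
def fundamentalSolution (n : ℕ) (x : EuclideanSpace ℝ (Fin n)) : ℝ :=
  if n = 1 then 1 / surfaceArea n * ‖x‖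
  else if n = 2 then 1 / surfaceArea n * Real.log ‖x‖
  else -(1 / (((n : ℝ) - 2) * surfaceArea n * ‖x‖ ^ (n - 2)))

/-- The direction `z / |z|` (used for `z ≠ 0`). -/
def dir {n : ℕ} (z : EuclideanSpace ℝ (Fin n)) : EuclideanSpace ℝ (Fin n) := ‖z‖⁻¹ • z

/-- The reflected point `z* = z / |z|²` (used for `z ≠ 0`). -/
def reflected {n : ℕ} (z : EuclideanSpace ℝ (Fin n)) : EuclideanSpace ℝ (Fin n) :=
  (‖z‖ ^ 2)⁻¹ • z

/-- `(I - z/|z| ⊗ z/|z|) x`, the component of `x` orthogonal to `z` (used for `z ≠ 0`). -/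
def perpPart {n : ℕ} (z x : EuclideanSpace ℝ (Fin n)) : EuclideanSpace ℝ (Fin n) :=
  x - ⟪dir z, x⟫ • dir z

/-- The Green's function of the Neumann-Poisson problem on the unit ball,
`Φ(x - z) + 1/ω_n ∫₀^{|z|} ((x · z/|z| - 1/s) / |s x - z/|z||ⁿ + 1/s) ds - |x|² / (2 ω_n)`.
For `z = 0` the integral runs over an empty interval and vanishes. -/
def poissonGreen (n : ℕ) (z x : EuclideanSpace ℝ (Fin n)) : ℝ :=
  fundamentalSolution n (x - z)
    + 1 / surfaceArea n *
      (∫ s in (0 : ℝ)..‖z‖, ((⟪x, dir z⟫ - 1 / s) / ‖s • x - dir z‖ ^ n + 1 / s))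
    - 1 / (2 * surfaceArea n) * ‖x‖ ^ 2

/-- The Green's function of the EEG problem on the unit ball. The second branch is the general
formula, which contains divisions by `|z|`; the first branch is its limit as `z → 0`. -/
def eegGreen (n : ℕ) (D z x : EuclideanSpace ℝ (Fin n)) : ℝ :=
  if z = 0 then
    1 / surfaceArea n * ⟪D, (1 / ‖x‖ ^ n) • x + ((n : ℝ) - 1) • x⟫
  else
    1 / surfaceArea n *
      ⟪D, (1 / ‖x - z‖ ^ n) • (x - z)
          - ((⟪x, z⟫ - 1) / ‖‖z‖ • x - dir z‖ ^ n) • ((1 / ‖z‖ ^ 2) • z)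
          - (1 / ‖z‖ ^ 2) • z
          - (∫ s in (0 : ℝ)..‖z‖,
              (1 / ‖s • x - dir z‖ ^ n
                + n * ((s * ⟪x, dir z⟫ - 1) / ‖s • x - dir z‖ ^ (n + 2)))) •
            ((1 / ‖z‖) • perpPart z x)⟫

/-- The second form of the Green's function of the EEG problem (used for `z ≠ 0`, `x ≠ 0`). -/
def eegGreenAlt (n : ℕ) (D z x : EuclideanSpace ℝ (Fin n)) : ℝ :=
  1 / surfaceArea n *
    ⟪D, (1 / ‖x - z‖ ^ n) • (x - z)
        - ((⟪x, z⟫ - 1) / (‖z‖ ^ n * ‖x - reflected z‖ ^ n)) • reflected z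
        - reflected z
        - (⟪x, dir z⟫ / ‖x‖ ^ 2 * (1 - 1 / (‖z‖ ^ n * ‖x - reflected z‖ ^ n))
            + (∫ s in (0 : ℝ)..‖z‖, 1 / ‖s • x - dir z‖ ^ n)
            + n * (⟪dir x, dir z⟫ ^ 2 - 1) *
              (∫ s in (0 : ℝ)..‖z‖, 1 / ‖s • x - dir z‖ ^ (n + 2))) •
          ((1 / ‖z‖) • perpPart z x)⟫

/-- `Δ u = div (D δ_z)` in the open unit ball, in the sense of distributions: `u` is locally
integrable there and `∫ u Δφ = ⟨div (D δ_z), φ⟩ = -D · ∇φ(z)` for every smooth `φ` with compact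
support in the ball. -/
def IsDistribSolution (n : ℕ) (D z : EuclideanSpace ℝ (Fin n))
    (u : EuclideanSpace ℝ (Fin n) → ℝ) : Prop :=
  LocallyIntegrableOn u (ball 0 1) volume ∧
  ∀ φ : EuclideanSpace ℝ (Fin n) → ℝ, ContDiff ℝ ∞ φ → HasCompactSupport φ →
    tsupport φ ⊆ ball 0 1 →
    ∫ x in ball (0 : EuclideanSpace ℝ (Fin n)) 1, u x * (Δ φ) x = -⟪D, (∇ φ) z⟫

/-- `u` is continuously differentiable up to the unit sphere away from the point `z`, and
`∇u · ν = 0` on the unit sphere, where `ν = x` is the outward normal at `x` and the derivative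
is the one relative to the closed ball. -/
def HasZeroNeumann (n : ℕ) (z : EuclideanSpace ℝ (Fin n))
    (u : EuclideanSpace ℝ (Fin n) → ℝ) : Prop :=
  ContDiffOn ℝ 1 u (closedBall 0 1 \ {z}) ∧
  ∀ x ∈ sphere (0 : EuclideanSpace ℝ (Fin n)) 1, fderivWithin ℝ u (closedBall 0 1) x x = 0

/-- `u` solves the EEG problem `Δ u = div (D δ_z)` in the open unit ball with homogeneous Neumann
boundary condition. -/
def IsEEGSolution (n : ℕ) (D z : EuclideanSpace ℝ (Fin n))
    (u : EuclideanSpace ℝ (Fin n) → ℝ) : Prop :=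
  IsDistribSolution n D z u ∧ HasZeroNeumann n z u

end

end EEGGreen

/-!
The proof rests on one formula that is free of divisions by `|z|`. With
`kernelFun n x z = (x · z - 1) / |z|ⁿ |x - z*|ⁿ + 1`, which is smooth for `|x| |z| < 1`, the integral
in the Neumann-Poisson Green's function is `∫₀¹ kernelFun n x (t z) / t dt` (substitute `s = t |z|`),
so that its `z`-gradient is `regularPart n x z = ∫₀¹ kernelGrad n x (t z) dt`, where `kernelGrad` is
the `z`-gradient of `kernelFun`. The component of `regularPart` along `z` is explicit by the
fundamental theorem of calculus, and the orthogonal component is a multiple of that of `x`; hence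
`eegGreen n D z x = D · ((x - z) / |x - z|ⁿ - regularPart n x z) / ω_n` for all `z`, including `z = 0`
(`eegGreen_eq`). The relation to the Poisson Green's function and the limit `z → 0` follow. The
second form of the formula is an integration of the derivative of `|s x - z/|z||⁻ⁿ` in `s`.

*Existence.* In polar coordinates, `x / |x|ⁿ` has the distributional divergence `ω_n δ_0`
(`integral_dipole_fderiv_self`), and as a limit of smooth gradients it is curl-free
(`integral_dipole_comm`). Together this gives `Δ (D · (x - y) / |x - y|ⁿ) = ω_n div (D δ_y)`
(`integral_dipole_laplacian`), which yields the singular part. Since `kernelFun n x z - 1` is a dipole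
at the reflected point `z*`, outside the ball, it is weakly harmonic in `x`; differentiation in `z`
and integration in `t` show the same for the regular part. By the symmetry
`kernelGrad n (t x) z = t kernelGrad n x (t z)`, the regular part is a primitive of `kernelGrad`
along rays in `x` as well (`fderiv_regularPart_self`), and on the unit sphere its radial derivative
cancels that of the dipole (`fderiv_dipole_self_of_norm_eq_one`).

*Uniqueness.* The difference of two solutions is weakly harmonic. Its average against the rescaled
radial weight `bumpProfile (c² |x - y|²)` does not depend on `c`, because the derivative of the
weight in `c` is the Laplacian of a test function. This gives a mean value property
(`IsWeaklyHarmonic.hasMeanValue`), removes the singularity at `z`, and implies the maximum principle,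
without any regularity theory. Applied to `v(x) - v(t x)`, the maximum principle transports the
vanishing of the radial derivative from the sphere to the ball as `t → 1`, so that `v` is constant on
rays, hence constant (`HasMeanValue.eq_apply_zero`).
-/

namespace EEGGreen

noncomputable section

/-! ### Integrals over a compact set that depend on a parameter -/

section Parametric

variable {X Y F : Type*} [TopologicalSpace Y] [MeasurableSpace Y] [OpensMeasurableSpace Y]
  [T2Space Y] [SecondCountableTopology Y] [NormedAddCommGroup F] {μ : Measure Y}

theorem aestronglyMeasurable_section [TopologicalSpace X] {f : X → Y → F} {U : Set X} {K : Set Y}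
    (hK : IsCompact K) (hf : ContinuousOn (Function.uncurry f) (U ×ˢ K)) {x : X} (hx : x ∈ U) :
    AEStronglyMeasurable (f x) (μ.restrict K) := by
  refine ContinuousOn.aestronglyMeasurable ?_ hK.measurableSet
  exact hf.comp (f := fun y => (x, y)) (by fun_prop) fun y hy => ⟨hx, hy⟩

variable [NormedSpace ℝ F] [IsFiniteMeasureOnCompacts μ]

theorem continuousOn_setIntegral_of_isCompact [TopologicalSpace X] [FirstCountableTopology X]
    [LocallyCompactSpace X] {f : X → Y → F} {U : Set X} {K : Set Y}
    (hU : IsOpen U) (hK : IsCompact K) (hf : ContinuousOn (Function.uncurry f) (U ×ˢ K)) :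
    ContinuousOn (fun x => ∫ y in K, f x y ∂μ) U := by
  intro x₀ hx₀
  obtain ⟨N, hN, hNU, hNc⟩ := local_compact_nhds (hU.mem_nhds hx₀)
  obtain ⟨C, hC⟩ := (hNc.prod hK).exists_bound_of_continuousOn
    (hf.mono (prod_mono hNU le_rfl))
  have : IsFiniteMeasure (μ.restrict K) := ⟨by simpa using hK.measure_lt_top⟩
  refine ContinuousAt.continuousWithinAt (continuousAt_of_dominated (bound := fun _ => C) ?_ ?_
    (integrable_const C) ?_)
  · filter_upwards [hN] with x hx using aestronglyMeasurable_section hK hf (hNU hx)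
  · filter_upwards [hN] with x hx
    filter_upwards [ae_restrict_mem hK.measurableSet] with y hy using hC (x, y) ⟨hx, hy⟩
  · filter_upwards [ae_restrict_mem hK.measurableSet] with y hy
    refine ContinuousOn.continuousAt (s := U) ?_ (hU.mem_nhds hx₀)
    exact hf.comp (f := fun x => (x, y)) (by fun_prop) fun x hx => ⟨hx, hy⟩

variable [NormedAddCommGroup X] [NormedSpace ℝ X] [LocallyCompactSpace X]

/-- Differentiation under the integral sign. The integrand itself need not be continuous in `y`,
so that an integrand with a removable singularity is allowed. -/
theorem hasFDerivAt_setIntegral_of_isCompact {f : X → Y → F} {f' : X → Y → X →L[ℝ] F}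
    {U : Set X} {K : Set Y} (hU : IsOpen U) (hK : IsCompact K)
    (hf : ∀ x ∈ U, IntegrableOn (f x) K μ)
    (hd : ∀ᵐ y ∂(μ.restrict K), ∀ x ∈ U, HasFDerivAt (fun x => f x y) (f' x y) x)
    (hf' : ContinuousOn (Function.uncurry f') (U ×ˢ K)) {x₀ : X} (hx₀ : x₀ ∈ U) :
    HasFDerivAt (fun x => ∫ y in K, f x y ∂μ) (∫ y in K, f' x₀ y ∂μ) x₀ := by
  obtain ⟨N, hN, hNU, hNc⟩ := local_compact_nhds (hU.mem_nhds hx₀)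
  obtain ⟨C, hC⟩ := (hNc.prod hK).exists_bound_of_continuousOn
    (hf'.mono (prod_mono hNU le_rfl))
  have : IsFiniteMeasure (μ.restrict K) := ⟨by simpa using hK.measure_lt_top⟩
  refine hasFDerivAt_integral_of_dominated_of_fderiv_le (bound := fun _ => C) hN ?_ (hf _ hx₀)
    (aestronglyMeasurable_section hK hf' hx₀) ?_ (integrable_const C) ?_
  · filter_upwards [hN] with x hx using (hf x (hNU hx)).aestronglyMeasurable
  · filter_upwards [ae_restrict_mem hK.measurableSet] with y hy x hx using hC (x, y) ⟨hx, hy⟩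
  · filter_upwards [hd] with y hy x hx using hy x (hNU hx)

theorem contDiffOn_one_of_hasFDerivAt {Z : Type*} [NormedAddCommGroup Z] [NormedSpace ℝ Z]
    {f : Z → F} {f' : Z → Z →L[ℝ] F} {U : Set Z} (hU : IsOpen U)
    (hd : ∀ x ∈ U, HasFDerivAt f (f' x) x) (hc : ContinuousOn f' U) : ContDiffOn ℝ 1 f U := by
  rw [show (1 : WithTop ℕ∞) = 0 + 1 by simp, contDiffOn_succ_iff_fderiv_of_isOpen hU]
  refine ⟨fun x hx => (hd x hx).differentiableAt.differentiableWithinAt, by simp, ?_⟩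
  rw [contDiffOn_zero]
  exact hc.congr fun x hx => (hd x hx).fderiv

end Parametric

/-! ### The kernel of the regular part -/

section Kernel

theorem isOpen_setOf_norm_mul_lt {E : Type*} [NormedAddCommGroup E] (x : E) :
    IsOpen {z : E | ‖x‖ * ‖z‖ < 1} :=
  isOpen_lt (by fun_prop) continuous_const

theorem isOpen_setOf_norm_mul_norm_lt {E : Type*} [NormedAddCommGroup E] :
    IsOpen {p : E × E | ‖p.1‖ * ‖p.2‖ < 1} :=
  isOpen_lt (by fun_prop) continuous_const

variable {E : Type*} [NormedAddCommGroup E] [InnerProductSpace ℝ E]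

/-- `1 - 2 x · z + |x|² |z|²`, which is `|z|² |x - z*|²` for `z ≠ 0`. -/
def quad (x z : E) : ℝ := 1 - 2 * ⟪x, z⟫ + ‖x‖ ^ 2 * ‖z‖ ^ 2

/-- The function `(x · z - 1) / |z|ⁿ |x - z*|ⁿ + 1`, written without a division by `|z|`. As a
function of `x` it is, up to constants, a dipole located at the reflected point `z*`. -/
def kernelFun (n : ℕ) (x z : E) : ℝ := (⟪x, z⟫ - 1) * quad x z ^ (-(n : ℝ) / 2) + 1

/-- The gradient of `kernelFun n x z` with respect to `z`. -/
def kernelGrad (n : ℕ) (x z : E) : E :=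
  quad x z ^ (-(n : ℝ) / 2) • x
    + (n * (⟪x, z⟫ - 1) * quad x z ^ (-(n : ℝ) / 2 - 1)) • (x - ‖x‖ ^ 2 • z)

/-- The regular part of the Green's function: the `z`-gradient of `∫₀¹ kernelFun n x (t z) / t dt`,
see `hasFDerivAt_integral_kernelFun_div`. -/
def regularPart (n : ℕ) (x z : E) : E := ∫ t in (0 : ℝ)..1, kernelGrad n x (t • z)

theorem quad_pos {x z : E} (h : ‖x‖ * ‖z‖ < 1) : 0 < quad x z := by
  have h1 := real_inner_le_norm x z
  have h2 : 0 < (1 - ‖x‖ * ‖z‖) ^ 2 := by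
    have : 0 < 1 - ‖x‖ * ‖z‖ := by linarith
    positivity
  unfold quad
  nlinarith

theorem quad_smul_left (t : ℝ) (x z : E) : quad (t • x) z = quad x (t • z) := by
  simp only [quad, real_inner_smul_left, real_inner_smul_right, norm_smul]
  ring

theorem kernelGrad_smul_left (n : ℕ) (t : ℝ) (x z : E) :
    kernelGrad n (t • x) z = t • kernelGrad n x (t • z) := by
  simp only [kernelGrad, quad_smul_left, real_inner_smul_left, real_inner_smul_right, norm_smul,
    mul_pow, Real.norm_eq_abs, sq_abs]
  module

theorem kernelFun_zero_right (n : ℕ) (x : E) : kernelFun n x 0 = 0 := by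
  simp [kernelFun, quad]

theorem hasFDerivAt_quad (x z : E) :
    HasFDerivAt (fun z => quad x z) (innerSL ℝ ((2 : ℝ) • (‖x‖ ^ 2 • z - x))) z := by
  have h1 : HasFDerivAt (fun z : E => ‖z‖ ^ 2) (2 • innerSL ℝ z) z :=
    (hasStrictFDerivAt_norm_sq z).hasFDerivAt
  have h2 : HasFDerivAt (fun z : E => ⟪x, z⟫) (innerSL ℝ x) z := (innerSL ℝ x).hasFDerivAt
  refine (((h2.const_mul 2).const_sub 1).add (h1.const_mul (‖x‖ ^ 2))).congr_fderiv ?_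
  ext v
  simp
  ring

theorem hasFDerivAt_kernelFun (n : ℕ) {x z : E} (h : 0 < quad x z) :
    HasFDerivAt (fun z => kernelFun n x z) (innerSL ℝ (kernelGrad n x z)) z := by
  have h2 : HasFDerivAt (fun z : E => ⟪x, z⟫) (innerSL ℝ x) z := (innerSL ℝ x).hasFDerivAt
  refine (((h2.sub_const 1).mul ((hasFDerivAt_quad x z).rpow_const
    (p := -(n : ℝ) / 2) (Or.inl h.ne'))).add_const 1).congr_fderiv ?_
  ext v
  simp [kernelGrad]
  ring

theorem contDiffAt_kernelGrad (n : ℕ) {p : E × E} (h : 0 < quad p.1 p.2) :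
    ContDiffAt ℝ ∞ (fun p : E × E => kernelGrad n p.1 p.2) p := by
  have h1 : ContDiffAt ℝ ∞ (fun p : E × E => quad p.1 p.2) p := by
    unfold quad
    have a := (contDiff_fst (𝕜 := ℝ) (E := E) (F := E) (n := ∞)).norm_sq ℝ
    have b := (contDiff_snd (𝕜 := ℝ) (E := E) (F := E) (n := ∞)).norm_sq ℝ
    have c := (contDiff_fst (𝕜 := ℝ) (E := E) (F := E) (n := ∞)).inner ℝ contDiff_snd
    fun_prop
  unfold kernelGrad
  have h2 := h1.rpow_const_of_ne (p := -(n : ℝ) / 2) h.ne'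
  have h3 := h1.rpow_const_of_ne (p := -(n : ℝ) / 2 - 1) h.ne'
  have a := (contDiff_fst (𝕜 := ℝ) (E := E) (F := E) (n := ∞)).norm_sq ℝ
  have c := (contDiff_fst (𝕜 := ℝ) (E := E) (F := E) (n := ∞)).inner ℝ contDiff_snd
  fun_prop

theorem continuousAt_kernelFun (n : ℕ) {p : E × E} (h : 0 < quad p.1 p.2) :
    ContinuousAt (fun p : E × E => kernelFun n p.1 p.2) p := by
  have h1 : Continuous (fun p : E × E => quad p.1 p.2) := by unfold quad; fun_prop
  unfold kernelFun
  have h2 := h1.continuousAt.rpow_const (p := -(n : ℝ) / 2) (Or.inl h.ne')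
  fun_prop

theorem norm_mul_norm_smul_lt {x z : E} (h : ‖x‖ * ‖z‖ < 1) {t : ℝ} (ht : t ∈ Icc (0 : ℝ) 1) :
    ‖x‖ * ‖t • z‖ < 1 := by
  rw [norm_smul, Real.norm_of_nonneg ht.1]
  calc ‖x‖ * (t * ‖z‖) = t * (‖x‖ * ‖z‖) := by ring
    _ ≤ 1 * (‖x‖ * ‖z‖) := by gcongr; exact ht.2
    _ < 1 := by simpa

theorem hasDerivAt_kernelFun_smul (n : ℕ) {x z : E} {t : ℝ} (h : 0 < quad x (t • z)) :
    HasDerivAt (fun t : ℝ => kernelFun n x (t • z)) ⟪kernelGrad n x (t • z), z⟫ t := by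
  have h1 : HasDerivAt (fun t : ℝ => t • z) z t := by
    simpa using (hasDerivAt_id t).smul_const z
  exact (hasFDerivAt_kernelFun n h).comp_hasDerivAt t h1

theorem continuousOn_kernelGrad_smul (n : ℕ) :
    ContinuousOn (fun p : (E × E) × ℝ => kernelGrad n p.1.1 (p.2 • p.1.2))
      ({p : E × E | ‖p.1‖ * ‖p.2‖ < 1} ×ˢ Icc 0 1) := by
  intro p hp
  refine ContinuousAt.continuousWithinAt ?_
  refine ContinuousAt.comp (g := fun p : E × E => kernelGrad n p.1 p.2)
    (f := fun p : (E × E) × ℝ => (p.1.1, p.2 • p.1.2)) ?_ (by fun_prop)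
  exact (contDiffAt_kernelGrad n (quad_pos (norm_mul_norm_smul_lt hp.1 hp.2))).continuousAt

theorem intervalIntegral_zero_one_eq {F : Type*} [NormedAddCommGroup F] [NormedSpace ℝ F]
    (f : ℝ → F) : ∫ t in (0 : ℝ)..1, f t = ∫ t in Icc (0 : ℝ) 1, f t := by
  rw [intervalIntegral.integral_of_le zero_le_one, integral_Icc_eq_integral_Ioc]

theorem continuousOn_kernelGrad_section (n : ℕ) {x z : E} (h : ‖x‖ * ‖z‖ < 1) :
    ContinuousOn (fun t : ℝ => kernelGrad n x (t • z)) (Icc 0 1) :=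
  (continuousOn_kernelGrad_smul n).comp (f := fun t : ℝ => ((x, z), t)) (by fun_prop)
    fun _ ht => ⟨h, ht⟩

theorem intervalIntegrable_kernelGrad (n : ℕ) {x z : E} (h : ‖x‖ * ‖z‖ < 1) :
    IntervalIntegrable (fun t : ℝ => kernelGrad n x (t • z)) volume 0 1 :=
  ((continuousOn_kernelGrad_section n h).mono (by simp)).intervalIntegrable

/-- `z · ∇` of the regular part is explicit, by the fundamental theorem of calculus. -/
theorem inner_regularPart_self [CompleteSpace E] (n : ℕ) {x z : E} (h : ‖x‖ * ‖z‖ < 1) :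
    ⟪regularPart n x z, z⟫ = kernelFun n x z := by
  have h1 : ∫ t in (0 : ℝ)..1, ⟪kernelGrad n x (t • z), z⟫ = kernelFun n x z := by
    rw [intervalIntegral.integral_eq_sub_of_hasDerivAt
      (f := fun t : ℝ => kernelFun n x (t • z))]
    · simp [kernelFun_zero_right]
    · intro t ht
      rw [uIcc_of_le zero_le_one] at ht
      exact hasDerivAt_kernelFun_smul n (quad_pos (norm_mul_norm_smul_lt h ht))
    · refine ContinuousOn.intervalIntegrable ?_
      rw [uIcc_of_le zero_le_one]
      exact (continuousOn_kernelGrad_section n h).inner continuousOn_const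
  rw [← h1, regularPart, real_inner_comm]
  simp_rw [real_inner_comm z]
  exact ((innerSL ℝ z).intervalIntegral_comp_comm (intervalIntegrable_kernelGrad n h)).symm

/-- `∇_z ∫₀¹ kernelFun n x (t z) / t dt`; the factors `t` and `1 / t` cancel. -/
theorem hasFDerivAt_integral_kernelFun_div [FiniteDimensional ℝ E] (n : ℕ) {x z : E}
    (h : ‖x‖ * ‖z‖ < 1) :
    HasFDerivAt (fun z => ∫ t in (0 : ℝ)..1, kernelFun n x (t • z) / t)
      (innerSL ℝ (regularPart n x z)) z := by
  have : ProperSpace E := FiniteDimensional.proper_real E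
  simp only [intervalIntegral_zero_one_eq]
  have key := hasFDerivAt_setIntegral_of_isCompact (μ := (volume : Measure ℝ))
    (f := fun z t => kernelFun n x (t • z) / t)
    (f' := fun z t => innerSL ℝ (kernelGrad n x (t • z)))
    (isOpen_setOf_norm_mul_lt x) (isCompact_Icc (a := (0 : ℝ)) (b := 1)) ?_ ?_ ?_ h
  · refine key.congr_fderiv ?_
    rw [regularPart, intervalIntegral_zero_one_eq]
    refine ContinuousLinearMap.integral_comp_comm (innerSL ℝ) ?_
    exact (continuousOn_kernelGrad_section n h).integrableOn_Icc
  · intro z hz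
    -- away from `t = 0` the integrand is a difference quotient of a differentiable function
    have hc : ContinuousOn (dslope (fun t : ℝ => kernelFun n x (t • z)) 0) (Icc 0 1) := by
      intro t ht
      have hd := hasDerivAt_kernelFun_smul n (quad_pos (norm_mul_norm_smul_lt hz ht))
      rcases eq_or_ne t 0 with rfl | h0
      · exact (continuousAt_dslope_same.2 hd.differentiableAt).continuousWithinAt
      · exact ((continuousAt_dslope_of_ne h0).2 hd.continuousAt).continuousWithinAt
    refine hc.integrableOn_Icc.congr ?_
    filter_upwards [Measure.ae_ne (volume.restrict (Icc (0 : ℝ) 1)) 0] with t ht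
    simp [dslope_of_ne _ ht, slope_def_field, kernelFun_zero_right]
  · filter_upwards [ae_restrict_mem measurableSet_Icc,
      Measure.ae_ne (volume.restrict (Icc (0 : ℝ) 1)) 0] with t ht h0 z hz
    have h1 : HasFDerivAt (fun z : E => t • z) (t • ContinuousLinearMap.id ℝ E) z :=
      (hasFDerivAt_id z).const_smul t
    have h2 := ((hasFDerivAt_kernelFun n (quad_pos (norm_mul_norm_smul_lt hz ht))).comp z
      h1).mul_const t⁻¹
    simp only [div_eq_mul_inv]
    refine h2.congr_fderiv ?_
    ext v
    simp [h0]
  · refine (innerSL ℝ).continuous.comp_continuousOn ?_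
    exact (continuousOn_kernelGrad_smul n).comp (f := fun p : E × ℝ => ((x, p.1), p.2))
      (by fun_prop) fun p hp => ⟨hp.1, hp.2⟩

theorem continuousOn_regularPart [FiniteDimensional ℝ E] (n : ℕ) :
    ContinuousOn (fun p : E × E => regularPart n p.1 p.2) {p : E × E | ‖p.1‖ * ‖p.2‖ < 1} := by
  have : ProperSpace E := FiniteDimensional.proper_real E
  simp only [regularPart, intervalIntegral_zero_one_eq]
  exact continuousOn_setIntegral_of_isCompact isOpen_setOf_norm_mul_norm_lt isCompact_Icc
    (continuousOn_kernelGrad_smul n)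

theorem contDiffOn_regularPart [FiniteDimensional ℝ E] (n : ℕ) (z : E) :
    ContDiffOn ℝ 1 (fun x => regularPart n x z) {x | ‖x‖ * ‖z‖ < 1} := by
  have : ProperSpace E := FiniteDimensional.proper_real E
  have hU : IsOpen {x : E | ‖x‖ * ‖z‖ < 1} := isOpen_lt (by fun_prop) continuous_const
  have hd : ∀ x : E, ‖x‖ * ‖z‖ < 1 → ∀ t ∈ Icc (0 : ℝ) 1,
      ContDiffAt ℝ ∞ (fun p : E × ℝ => kernelGrad n p.1 (p.2 • z)) (x, t) := fun x hx t ht =>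
    ContDiffAt.comp (g := fun p : E × E => kernelGrad n p.1 p.2)
      (f := fun p : E × ℝ => (p.1, p.2 • z)) (x, t)
      (contDiffAt_kernelGrad n (quad_pos (norm_mul_norm_smul_lt hx ht))) (by fun_prop)
  have hf' : ContinuousOn (Function.uncurry fun x t =>
      (fderiv ℝ (fun p : E × ℝ => kernelGrad n p.1 (p.2 • z)) (x, t)).comp
        (ContinuousLinearMap.inl ℝ E ℝ)) ({x | ‖x‖ * ‖z‖ < 1} ×ˢ Icc (0 : ℝ) 1) := by
    intro p hp
    refine ContinuousAt.continuousWithinAt (ContinuousAt.clm_comp ?_ continuousAt_const)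
    exact ((hd p.1 hp.1 p.2 hp.2).fderiv_right (m := 0) (by simp)).continuousAt
  refine contDiffOn_one_of_hasFDerivAt hU (f' := fun x => ∫ t in Icc (0 : ℝ) 1,
    (fderiv ℝ (fun p : E × ℝ => kernelGrad n p.1 (p.2 • z)) (x, t)).comp
      (ContinuousLinearMap.inl ℝ E ℝ)) ?_ ?_
  · intro x hx
    simp only [regularPart, intervalIntegral_zero_one_eq]
    refine hasFDerivAt_setIntegral_of_isCompact hU isCompact_Icc ?_ ?_ hf' hx
    · exact fun x hx => (continuousOn_kernelGrad_section n hx).integrableOn_Icc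
    · filter_upwards [ae_restrict_mem measurableSet_Icc] with t ht x hx
      have h1 : HasFDerivAt (fun x : E => (x, t)) (ContinuousLinearMap.inl ℝ E ℝ) x :=
        hasFDerivAt_prodMk_left x t
      exact ((hd x hx t ht).differentiableAt (by simp)).hasFDerivAt.comp x h1
  · exact continuousOn_setIntegral_of_isCompact hU isCompact_Icc hf'

/-- The derivative of the regular part in the radial direction `x` is explicit, although the full
derivative is not. -/
theorem fderiv_regularPart_self [FiniteDimensional ℝ E] (n : ℕ) {x z : E} (h : ‖x‖ * ‖z‖ < 1) :
    fderiv ℝ (fun x => regularPart n x z) x x = kernelGrad n x z := by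
  have hU : IsOpen {x : E | ‖x‖ * ‖z‖ < 1} := isOpen_lt (by fun_prop) continuous_const
  have hdiff : DifferentiableAt ℝ (fun x => regularPart n x z) x :=
    ((contDiffOn_regularPart n z).contDiffAt (hU.mem_nhds h)).differentiableAt (by simp)
  have h1 : HasDerivAt (fun s : ℝ => s • x) x 1 := by
    simpa using (hasDerivAt_id (1 : ℝ)).smul_const x
  have h2 : HasDerivAt (fun s : ℝ => regularPart n (s • x) z)
      (fderiv ℝ (fun x => regularPart n x z) x x) 1 := by
    refine HasFDerivAt.comp_hasDerivAt (f := fun s : ℝ => s • x)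
      (l := fun x => regularPart n x z) (1 : ℝ) ?_ h1
    rw [one_smul]
    exact hdiff.hasFDerivAt
  -- along the ray through `x` the regular part is a primitive of the kernel
  have h3 : ∀ s : ℝ, regularPart n (s • x) z = ∫ t in (0 : ℝ)..s, kernelGrad n x (t • z) := by
    intro s
    have h4 := intervalIntegral.smul_integral_comp_mul_right (a := 0) (b := 1)
      (fun t => kernelGrad n x (t • z)) s
    simp only [zero_mul, one_mul] at h4
    rw [← h4, ← intervalIntegral.integral_smul]
    simp only [regularPart, kernelGrad_smul_left, smul_smul, mul_comm s]
  have hca : ∀ t ∈ Icc (0 : ℝ) 1, ContinuousAt (fun t : ℝ => kernelGrad n x (t • z)) t :=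
    fun t ht => ContinuousAt.comp (g := fun p : E × E => kernelGrad n p.1 p.2)
      (f := fun t : ℝ => (x, t • z))
      (contDiffAt_kernelGrad n (quad_pos (norm_mul_norm_smul_lt h ht))).continuousAt
      (by fun_prop)
  -- near `t = 1`, also beyond it, as the fundamental theorem of calculus is applied at `t = 1`
  have hopen : ∀ᶠ t : ℝ in 𝓝 1, ContinuousAt (fun t : ℝ => kernelGrad n x (t • z)) t := by
    have : IsOpen {t : ℝ | ‖x‖ * ‖t • z‖ < 1} := isOpen_lt (by fun_prop) continuous_const
    filter_upwards [this.mem_nhds (by simpa using h)] with t ht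
    exact ContinuousAt.comp (g := fun p : E × E => kernelGrad n p.1 p.2)
      (f := fun t : ℝ => (x, t • z)) (contDiffAt_kernelGrad n (quad_pos ht)).continuousAt
      (by fun_prop)
  have h5 : HasDerivAt (fun s : ℝ => ∫ t in (0 : ℝ)..s, kernelGrad n x (t • z))
      (kernelGrad n x ((1 : ℝ) • z)) 1 := by
    refine intervalIntegral.integral_hasDerivAt_right (intervalIntegrable_kernelGrad n h) ?_
      (hca 1 (by simp))
    obtain ⟨V, hV, hVo, h1V⟩ := _root_.eventually_nhds_iff.1 hopen
    exact ContinuousOn.stronglyMeasurableAtFilter hVo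
      (fun t ht => (hV t ht).continuousWithinAt) 1 h1V
  rw [one_smul] at h5
  simp only [h3] at h2
  exact h2.unique h5

end Kernel

/-! ### The Green's functions in terms of the kernel -/

section Formulas

variable {n : ℕ}

theorem surfaceArea_pos (hn : 1 ≤ n) : 0 < surfaceArea n := by
  have : Nonempty (Fin n) := ⟨⟨0, hn⟩⟩
  have : NeZero n := ⟨by omega⟩
  rw [surfaceArea, measureReal_def]
  refine ENNReal.toReal_pos ?_ (measure_ne_top _ _)
  exact Measure.measure_univ_ne_zero.2
    (Measure.toSphere_ne_zero (volume : Measure (EuclideanSpace ℝ (Fin n))))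

theorem norm_dir {z : EuclideanSpace ℝ (Fin n)} (hz : z ≠ 0) : ‖dir z‖ = 1 := by
  simp [dir, norm_smul, hz]

theorem norm_smul_dir (z : EuclideanSpace ℝ (Fin n)) : ‖z‖ • dir z = z := by
  rcases eq_or_ne z 0 with rfl | hz
  · simp [dir]
  · simp [dir, hz]

theorem quad_smul_dir {z : EuclideanSpace ℝ (Fin n)} (hz : z ≠ 0)
    (x : EuclideanSpace ℝ (Fin n)) (s : ℝ) : quad x (s • dir z) = ‖s • x - dir z‖ ^ 2 := by
  rw [← quad_smul_left, norm_sub_sq_real, quad, norm_dir hz]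
  ring

theorem sq_rpow_neg_half {N : ℝ} (hN : 0 ≤ N) (k : ℕ) :
    (N ^ 2) ^ (-(k : ℝ) / 2) = 1 / N ^ k := by
  rw [← Real.rpow_natCast N 2, ← Real.rpow_mul hN, ← Real.rpow_natCast N k, one_div,
    ← Real.rpow_neg hN]
  congr 1
  push_cast
  ring

theorem quad_rpow_smul_dir {z : EuclideanSpace ℝ (Fin n)} (hz : z ≠ 0)
    (x : EuclideanSpace ℝ (Fin n)) (s : ℝ) (k : ℕ) :
    quad x (s • dir z) ^ (-(k : ℝ) / 2) = 1 / ‖s • x - dir z‖ ^ k := by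
  rw [quad_smul_dir hz, sq_rpow_neg_half (norm_nonneg _)]

theorem quad_rpow_sub_one {E : Type*} [NormedAddCommGroup E] [InnerProductSpace ℝ E] (x z : E)
    (k : ℕ) : quad x z ^ (-(k : ℝ) / 2 - 1) = quad x z ^ (-((k + 2 : ℕ) : ℝ) / 2) := by
  congr 1
  push_cast
  ring

theorem mul_norm_smul_dir (t : ℝ) (z : EuclideanSpace ℝ (Fin n)) :
    (t * ‖z‖) • dir z = t • z := by
  rw [mul_smul, norm_smul_dir]

theorem inner_eq_norm_mul_inner_dir (x z : EuclideanSpace ℝ (Fin n)) :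
    ⟪x, z⟫ = ‖z‖ * ⟪x, dir z⟫ := by
  conv_lhs => rw [← norm_smul_dir z, real_inner_smul_right]

/-- The substitution `s = t |z|` in the integral that defines `poissonGreen`. -/
theorem integral_poissonGreen_eq (x z : EuclideanSpace ℝ (Fin n)) :
    (∫ s in (0 : ℝ)..‖z‖, ((⟪x, dir z⟫ - 1 / s) / ‖s • x - dir z‖ ^ n + 1 / s)) =
      ∫ t in (0 : ℝ)..1, kernelFun n x (t • z) / t := by
  rcases eq_or_ne z 0 with rfl | hz
  · simp [kernelFun_zero_right]
  have h4 := intervalIntegral.smul_integral_comp_mul_right (a := 0) (b := 1)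
    (fun s => (⟪x, dir z⟫ - 1 / s) / ‖s • x - dir z‖ ^ n + 1 / s) ‖z‖
  rw [zero_mul, one_mul] at h4
  rw [← h4, ← intervalIntegral.integral_smul]
  refine intervalIntegral.integral_congr_ae (Eventually.of_forall fun t ht => ?_)
  rw [uIoc_of_le zero_le_one] at ht
  have ht0 : t ≠ 0 := ht.1.ne'
  have hz0 : ‖z‖ ≠ 0 := norm_ne_zero_iff.2 hz
  rw [kernelFun, ← mul_norm_smul_dir t z, quad_rpow_smul_dir hz, real_inner_smul_right, smul_eq_mul]
  field_simp

theorem poissonGreen_eq (x z : EuclideanSpace ℝ (Fin n)) :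
    poissonGreen n z x = fundamentalSolution n (x - z)
      + 1 / surfaceArea n * (∫ t in (0 : ℝ)..1, kernelFun n x (t • z) / t)
      - 1 / (2 * surfaceArea n) * ‖x‖ ^ 2 := by
  rw [poissonGreen, integral_poissonGreen_eq]

theorem hasFDerivAt_norm_of_ne {E : Type*} [NormedAddCommGroup E] [InnerProductSpace ℝ E] {y : E}
    (hy : y ≠ 0) : HasFDerivAt (fun y : E => ‖y‖) (‖y‖⁻¹ • innerSL ℝ y) y := by
  have h1 : HasFDerivAt (fun z : E => ‖z‖ ^ 2) (2 • innerSL ℝ y) y :=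
    (hasStrictFDerivAt_norm_sq y).hasFDerivAt
  have h2 := h1.sqrt (by simpa using hy)
  simp only [Real.sqrt_sq (norm_nonneg _)] at h2
  refine h2.congr_fderiv ?_
  ext v
  simp
  ring

theorem hasFDerivAt_fundamentalSolution (hn : 1 ≤ n) {y : EuclideanSpace ℝ (Fin n)} (hy : y ≠ 0) :
    HasFDerivAt (fundamentalSolution n)
      (innerSL ℝ ((1 / surfaceArea n) • (1 / ‖y‖ ^ n) • y)) y := by
  have hN := hasFDerivAt_norm_of_ne hy
  have hω := (surfaceArea_pos hn).ne'
  have hy0 : ‖y‖ ≠ 0 := norm_ne_zero_iff.2 hy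
  suffices h : ∃ h : ℝ → ℝ, (∀ y, fundamentalSolution n y = h ‖y‖) ∧
      HasDerivAt h (1 / surfaceArea n * (‖y‖ / ‖y‖ ^ n)) ‖y‖ by
    obtain ⟨h, h1, h2⟩ := h
    rw [show fundamentalSolution n = fun y => h ‖y‖ from funext h1]
    refine (h2.comp_hasFDerivAt y hN).congr_fderiv ?_
    ext v
    simp only [map_smul, _root_.smul_apply, innerSL_apply_apply, smul_eq_mul]
    field_simp
  by_cases h1 : n = 1
  · refine ⟨fun r => 1 / surfaceArea n * r, fun y => by simp [fundamentalSolution, h1], ?_⟩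
    refine ((hasDerivAt_id ‖y‖).const_mul (1 / surfaceArea n)).congr_deriv ?_
    subst h1
    field_simp
  by_cases h2 : n = 2
  · refine ⟨fun r => 1 / surfaceArea n * Real.log r,
      fun y => by simp [fundamentalSolution, h2], ?_⟩
    refine ((Real.hasDerivAt_log hy0).const_mul (1 / surfaceArea n)).congr_deriv ?_
    subst h2
    field_simp
  obtain ⟨m, rfl⟩ : ∃ m, n = m + 3 := ⟨n - 3, by omega⟩
  refine ⟨fun r => -(1 / ((((m + 3 : ℕ) : ℝ) - 2) * surfaceArea (m + 3) * r ^ (m + 1))),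
    fun y => by simp [fundamentalSolution], ?_⟩
  have hm : ((m + 3 : ℕ) : ℝ) - 2 ≠ 0 := by
    push_cast
    have : (0 : ℝ) ≤ m := Nat.cast_nonneg m
    linarith
  have hd := ((((hasDerivAt_pow (m + 1) ‖y‖).const_mul
    ((((m + 3 : ℕ) : ℝ) - 2) * surfaceArea (m + 3))).inv (by positivity)).neg)
  simp only [one_div]
  refine hd.congr_deriv ?_
  have hm' : (m : ℝ) + 3 - 2 ≠ 0 := by exact_mod_cast hm
  push_cast
  field_simp
  ring

theorem continuousOn_quad_rpow {E : Type*} [NormedAddCommGroup E] [InnerProductSpace ℝ E]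
    {x z : E} (h : ‖x‖ * ‖z‖ < 1) (p : ℝ) :
    ContinuousOn (fun t : ℝ => quad x (t • z) ^ p) (Icc 0 1) := by
  refine ContinuousOn.rpow_const ?_ fun t ht => Or.inl
    (quad_pos (norm_mul_norm_smul_lt h ht)).ne'
  unfold quad
  fun_prop

theorem norm_mul_norm_lt_one {x z : EuclideanSpace ℝ (Fin n)}
    (hx : x ∈ closedBall (0 : EuclideanSpace ℝ (Fin n)) 1)
    (hz : z ∈ ball (0 : EuclideanSpace ℝ (Fin n)) 1) : ‖x‖ * ‖z‖ < 1 := by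
  rw [mem_closedBall_zero_iff] at hx
  rw [mem_ball_zero_iff] at hz
  calc ‖x‖ * ‖z‖ ≤ 1 * ‖z‖ := by gcongr
    _ < 1 := by simpa

/-- The regular part splits into its explicit component along `z` and an integral multiple of the
orthogonal component of `x`. -/
theorem regularPart_eq {x z : EuclideanSpace ℝ (Fin n)} (h : ‖x‖ * ‖z‖ < 1) (hz : z ≠ 0) :
    regularPart n x z =
      ((⟪x, z⟫ - 1) / ‖‖z‖ • x - dir z‖ ^ n) • ((1 / ‖z‖ ^ 2) • z) + (1 / ‖z‖ ^ 2) • z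
        + (∫ s in (0 : ℝ)..‖z‖,
              (1 / ‖s • x - dir z‖ ^ n
                + n * ((s * ⟪x, dir z⟫ - 1) / ‖s • x - dir z‖ ^ (n + 2)))) •
            ((1 / ‖z‖) • perpPart z x) := by
  have hz0 : ‖z‖ ≠ 0 := norm_ne_zero_iff.2 hz
  set α : ℝ → ℝ := fun t => quad x (t • z) ^ (-(n : ℝ) / 2)
    + n * (t * ⟪x, z⟫ - 1) * quad x (t • z) ^ (-(n : ℝ) / 2 - 1) with hα
  set β : ℝ → ℝ := fun t => n * (t * ⟪x, z⟫ - 1) * quad x (t • z) ^ (-(n : ℝ) / 2 - 1)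
    * ‖x‖ ^ 2 * t with hβ
  have hαc : IntervalIntegrable α volume 0 1 := by
    refine ContinuousOn.intervalIntegrable ?_
    rw [uIcc_of_le zero_le_one]
    have h1 := continuousOn_quad_rpow h (-(n : ℝ) / 2)
    have h2 := continuousOn_quad_rpow h (-(n : ℝ) / 2 - 1)
    fun_prop
  have hβc : IntervalIntegrable β volume 0 1 := by
    refine ContinuousOn.intervalIntegrable ?_
    rw [uIcc_of_le zero_le_one]
    have h2 := continuousOn_quad_rpow h (-(n : ℝ) / 2 - 1)
    fun_prop
  have hV : regularPart n x z = (∫ t in (0 : ℝ)..1, α t) • x - (∫ t in (0 : ℝ)..1, β t) • z := by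
    rw [← intervalIntegral.integral_smul_const, ← intervalIntegral.integral_smul_const,
      ← intervalIntegral.integral_sub (hαc.smul_continuousOn continuousOn_const)
        (hβc.smul_continuousOn continuousOn_const)]
    unfold regularPart
    congr 1
    ext1 t
    rw [kernelGrad, hα, hβ, real_inner_smul_right]
    module
  have hI : (∫ s in (0 : ℝ)..‖z‖,
      (1 / ‖s • x - dir z‖ ^ n + n * ((s * ⟪x, dir z⟫ - 1) / ‖s • x - dir z‖ ^ (n + 2)))) =
      ‖z‖ * ∫ t in (0 : ℝ)..1, α t := by
    have h4 := intervalIntegral.smul_integral_comp_mul_right (a := 0) (b := 1)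
      (fun s => 1 / ‖s • x - dir z‖ ^ n
        + n * ((s * ⟪x, dir z⟫ - 1) / ‖s • x - dir z‖ ^ (n + 2))) ‖z‖
    rw [zero_mul, one_mul] at h4
    rw [← h4, smul_eq_mul]
    congr 2
    ext1 t
    rw [hα]
    simp only
    rw [quad_rpow_sub_one, ← mul_norm_smul_dir t z, quad_rpow_smul_dir hz, quad_rpow_smul_dir hz,
      inner_eq_norm_mul_inner_dir x z]
    ring
  have hγ := inner_regularPart_self n h
  have hK : kernelFun n x z = (⟪x, z⟫ - 1) / ‖‖z‖ • x - dir z‖ ^ n + 1 := by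
    have h5 := quad_rpow_smul_dir hz x ‖z‖ n
    rw [norm_smul_dir] at h5
    rw [kernelFun, h5]
    ring
  rw [hV, inner_sub_left, real_inner_smul_left, real_inner_smul_left, real_inner_self_eq_norm_sq,
    hK] at hγ
  have hP : perpPart z x = x - (⟪x, z⟫ / ‖z‖ ^ 2) • z := by
    rw [perpPart, dir, real_inner_smul_left, real_inner_comm, smul_smul]
    congr 2
    field_simp
  rw [hV, hI, hP]
  set A := ∫ t in (0 : ℝ)..1, α t
  set B := ∫ t in (0 : ℝ)..1, β t
  have hB : B = (A * ⟪x, z⟫ - ((⟪x, z⟫ - 1) / ‖‖z‖ • x - dir z‖ ^ n + 1)) / ‖z‖ ^ 2 := by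
    field_simp
    linarith
  rw [hB]
  match_scalars
  · field_simp
  · field_simp
    ring

/-- The formula for the Green's function that covers `z = 0` and `z ≠ 0` uniformly. -/
theorem eegGreen_eq (D : EuclideanSpace ℝ (Fin n)) {x z : EuclideanSpace ℝ (Fin n)}
    (h : ‖x‖ * ‖z‖ < 1) :
    eegGreen n D z x =
      1 / surfaceArea n * ⟪D, (1 / ‖x - z‖ ^ n) • (x - z) - regularPart n x z⟫ := by
  by_cases hz : z = 0
  · subst hz
    have : regularPart n x (0 : EuclideanSpace ℝ (Fin n)) = (1 - n : ℝ) • x := by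
      simp [regularPart, kernelGrad, quad, sub_smul, ← sub_eq_add_neg]
    rw [eegGreen, if_pos rfl, this, sub_zero]
    congr 2
    module
  · rw [eegGreen, if_neg hz, regularPart_eq h hz]
    congr 2
    abel

theorem hasFDerivAt_poissonGreen (hn : 1 ≤ n) {x z : EuclideanSpace ℝ (Fin n)} (hxz : x ≠ z)
    (h : ‖x‖ * ‖z‖ < 1) :
    HasFDerivAt (fun w => poissonGreen n w x)
      (innerSL ℝ ((1 / surfaceArea n) • (regularPart n x z - (1 / ‖x - z‖ ^ n) • (x - z)))) z := by
  have h1 : HasFDerivAt (fun w => x - w) (-ContinuousLinearMap.id ℝ (EuclideanSpace ℝ (Fin n))) z :=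
    (hasFDerivAt_id z).const_sub x
  have h2 := (hasFDerivAt_fundamentalSolution hn (sub_ne_zero.2 hxz)).comp z h1
  have h3 := hasFDerivAt_integral_kernelFun_div n h
  simp only [poissonGreen_eq]
  refine ((h2.add (h3.const_mul (1 / surfaceArea n))).sub_const _).congr_fderiv ?_
  ext v
  simp
  ring

theorem differentiableAt_poissonGreen_and_eegGreen_eq (hn : 1 ≤ n)
    (D : EuclideanSpace ℝ (Fin n)) {x z : EuclideanSpace ℝ (Fin n)} (hxz : x ≠ z)
    (h : ‖x‖ * ‖z‖ < 1) :
    DifferentiableAt ℝ (fun w => poissonGreen n w x) z ∧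
      eegGreen n D z x = -⟪D, (∇ (fun w => poissonGreen n w x)) z⟫ := by
  have h1 := hasFDerivAt_poissonGreen hn hxz h
  refine ⟨h1.differentiableAt, ?_⟩
  have h2 : HasGradientAt (fun w => poissonGreen n w x)
      ((1 / surfaceArea n) • (regularPart n x z - (1 / ‖x - z‖ ^ n) • (x - z))) z :=
    h1.congr_fderiv rfl
  rw [h2.gradient, eegGreen_eq D h, real_inner_smul_right, ← mul_neg, ← inner_neg_right, neg_sub]

theorem tendsto_eegGreen_zero (D : EuclideanSpace ℝ (Fin n)) {x : EuclideanSpace ℝ (Fin n)}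
    (hx : x ≠ 0) :
    Tendsto (fun z => eegGreen n D z x) (𝓝[≠] 0) (𝓝 (eegGreen n D 0 x)) := by
  refine Tendsto.mono_left ?_ nhdsWithin_le_nhds
  have hU := (isOpen_setOf_norm_mul_lt x).mem_nhds
    (show ‖x‖ * ‖(0 : EuclideanSpace ℝ (Fin n))‖ < 1 by simp)
  have he : (fun z => 1 / surfaceArea n * ⟪D, (1 / ‖x - z‖ ^ n) • (x - z) - regularPart n x z⟫)
      =ᶠ[𝓝 0] fun z => eegGreen n D z x := by
    filter_upwards [hU] with z hz using (eegGreen_eq D hz).symm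
  refine Tendsto.congr' he ?_
  rw [eegGreen_eq D (by simp)]
  have hV : ContinuousAt (fun z => regularPart n x z) (0 : EuclideanSpace ℝ (Fin n)) :=
    ContinuousAt.comp (g := fun p : EuclideanSpace ℝ (Fin n) × EuclideanSpace ℝ (Fin n) =>
        regularPart n p.1 p.2) (f := fun z => (x, z))
      ((continuousOn_regularPart n).continuousAt
        (isOpen_setOf_norm_mul_norm_lt.mem_nhds (by simp))) (by fun_prop)
  have hne : ‖x - 0‖ ^ n ≠ 0 := by simpa using fun h => absurd h hx
  have : ContinuousAt (fun z => 1 / surfaceArea n *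
      ⟪D, (1 / ‖x - z‖ ^ n) • (x - z) - regularPart n x z⟫) (0 : EuclideanSpace ℝ (Fin n)) := by
    fun_prop (disch := exact hne)
  exact this.tendsto

theorem norm_mul_norm_sub_reflected {z : EuclideanSpace ℝ (Fin n)} (hz : z ≠ 0)
    (x : EuclideanSpace ℝ (Fin n)) : ‖z‖ * ‖x - reflected z‖ = ‖‖z‖ • x - dir z‖ := by
  have hz0 : ‖z‖ ≠ 0 := norm_ne_zero_iff.2 hz
  rw [← Real.norm_of_nonneg (norm_nonneg z), ← norm_smul, Real.norm_of_nonneg (norm_nonneg z),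
    smul_sub, reflected, dir, smul_smul]
  congr 3
  field_simp

/-- With `Q(s) = |s x - z/|z||²` and `c = x · z/|z|`, the derivative of `Q(s)^(-n/2)` is
`n (c - s |x|²) Q(s)^(-n/2-1)`; this converts one integral into the other. -/
theorem eegGreen_eq_eegGreenAlt (D : EuclideanSpace ℝ (Fin n)) {x z : EuclideanSpace ℝ (Fin n)}
    (h : ‖x‖ * ‖z‖ < 1) (hz : z ≠ 0) (hx : x ≠ 0) : eegGreen n D z x = eegGreenAlt n D z x := by
  have hz0 : ‖z‖ ≠ 0 := norm_ne_zero_iff.2 hz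
  have hx0 : ‖x‖ ≠ 0 := norm_ne_zero_iff.2 hx
  have hN := norm_mul_norm_sub_reflected hz x
  have hQ : ∀ s ∈ uIcc 0 ‖z‖, 0 < quad x (s • dir z) := by
    intro s hs
    rw [uIcc_of_le (norm_nonneg z)] at hs
    refine quad_pos ?_
    rw [norm_smul, norm_dir hz, mul_one, Real.norm_of_nonneg hs.1]
    exact lt_of_le_of_lt (by gcongr; exact hs.2) h
  have hcont : ∀ k : ℕ, ContinuousOn (fun s : ℝ => 1 / ‖s • x - dir z‖ ^ k) (uIcc 0 ‖z‖) := by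
    intro k
    refine ContinuousOn.div continuousOn_const (by fun_prop) fun s hs => ?_
    have := hQ s hs
    rw [quad_smul_dir hz] at this
    exact pow_ne_zero _ fun h0 => by simp [h0] at this
  set c := ⟪x, dir z⟫ with hc
  have hder : ∀ s ∈ uIcc 0 ‖z‖, HasDerivAt (fun s : ℝ => 1 / ‖s • x - dir z‖ ^ n)
      (n * (c - s * ‖x‖ ^ 2) * (1 / ‖s • x - dir z‖ ^ (n + 2))) s := by
    intro s hs
    have h1 : HasDerivAt (fun s : ℝ => quad x (s • dir z)) (-2 * c + 2 * s * ‖x‖ ^ 2) s := by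
      have h2 : (fun s : ℝ => quad x (s • dir z)) =
          fun s : ℝ => 1 - 2 * (s * c) + ‖x‖ ^ 2 * s ^ 2 := by
        ext1 s
        simp [quad, real_inner_smul_right, norm_smul, norm_dir hz, ← hc]
      rw [h2]
      refine (((((hasDerivAt_id s).mul_const c).const_mul 2).const_sub 1).add
        ((hasDerivAt_pow 2 s).const_mul (‖x‖ ^ 2))).congr_deriv ?_
      simp
      ring
    have h3 := h1.rpow_const (p := -(n : ℝ) / 2) (Or.inl (hQ s hs).ne')
    rw [quad_rpow_sub_one, quad_rpow_smul_dir hz] at h3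
    simp only [quad_rpow_smul_dir hz] at h3
    refine h3.congr_deriv ?_
    ring
  have hftc := intervalIntegral.integral_eq_sub_of_hasDerivAt hder
    (ContinuousOn.intervalIntegrable (by have := hcont (n + 2); fun_prop))
  simp only [zero_smul, zero_sub, norm_neg, norm_dir hz, one_pow, div_one] at hftc
  have hint : (∫ s in (0 : ℝ)..‖z‖,
      (1 / ‖s • x - dir z‖ ^ n + n * ((s * c - 1) / ‖s • x - dir z‖ ^ (n + 2)))) =
      c / ‖x‖ ^ 2 * (1 - 1 / ‖‖z‖ • x - dir z‖ ^ n)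
        + (∫ s in (0 : ℝ)..‖z‖, 1 / ‖s • x - dir z‖ ^ n)
        + n * (⟪dir x, dir z⟫ ^ 2 - 1) * (∫ s in (0 : ℝ)..‖z‖, 1 / ‖s • x - dir z‖ ^ (n + 2)) := by
    have hd : ⟪dir x, dir z⟫ = c / ‖x‖ := by
      rw [dir, real_inner_smul_left, ← hc]
      field_simp
    have h5 : ∀ s : ℝ, 1 / ‖s • x - dir z‖ ^ n + n * ((s * c - 1) / ‖s • x - dir z‖ ^ (n + 2)) =
        1 / ‖s • x - dir z‖ ^ n
        + (-(c / ‖x‖ ^ 2) * (n * (c - s * ‖x‖ ^ 2) * (1 / ‖s • x - dir z‖ ^ (n + 2)))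
          + n * (⟪dir x, dir z⟫ ^ 2 - 1) * (1 / ‖s • x - dir z‖ ^ (n + 2))) := by
      intro s
      rw [hd]
      field_simp
      ring
    simp only [h5]
    have i1 := (hcont n).intervalIntegrable (μ := volume)
    have i2 : IntervalIntegrable (fun s : ℝ => -(c / ‖x‖ ^ 2) *
        (n * (c - s * ‖x‖ ^ 2) * (1 / ‖s • x - dir z‖ ^ (n + 2)))) volume 0 ‖z‖ :=
      ContinuousOn.intervalIntegrable (by have := hcont (n + 2); fun_prop)
    have i3 : IntervalIntegrable (fun s : ℝ => n * (⟪dir x, dir z⟫ ^ 2 - 1) *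
        (1 / ‖s • x - dir z‖ ^ (n + 2))) volume 0 ‖z‖ :=
      ContinuousOn.intervalIntegrable (by have := hcont (n + 2); fun_prop)
    rw [intervalIntegral.integral_add i1 (i2.add i3), intervalIntegral.integral_add i2 i3,
      intervalIntegral.integral_const_mul, intervalIntegral.integral_const_mul, hftc]
    ring
  have hr : (1 / ‖z‖ ^ 2) • z = reflected z := by rw [reflected, one_div]
  rw [eegGreen, if_neg hz, eegGreenAlt, ← mul_pow, hN, ← hc, hint, hr]

end Formulas

/-! ### The dipole field and the Laplacian -/

section Dipole

open Module (finrank)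

theorem norm_one_div_pow_smul {E : Type*} [NormedAddCommGroup E] [InnerProductSpace ℝ E] (k : ℕ)
    (x : E) : ‖(1 / ‖x‖ ^ k) • x‖ = ‖x‖ / ‖x‖ ^ k := by
  rw [norm_smul, Real.norm_of_nonneg (by positivity)]
  ring

theorem clm_apply_eq_sum {E ι : Type*} [NormedAddCommGroup E] [InnerProductSpace ℝ E] [Fintype ι]
    (b : OrthonormalBasis ι ℝ E) (L : E →L[ℝ] ℝ) (x : E) : L x = ∑ i, ⟪b i, x⟫ * L (b i) := by
  conv_lhs => rw [← b.sum_repr' x]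
  simp only [map_sum, map_smul, smul_eq_mul]

variable {E : Type*} [NormedAddCommGroup E] [InnerProductSpace ℝ E] [FiniteDimensional ℝ E]
  [MeasurableSpace E] [BorelSpace E]

/-- Integration in polar coordinates. -/
theorem integral_eq_integral_sphere_integral_Ioi [Nontrivial E] {f : E → ℝ} (hf : Integrable f) :
    ∫ x, f x = ∫ θ : sphere (0 : E) 1, (∫ r in Ioi (0 : ℝ), r ^ (finrank ℝ E - 1) * f (r • θ.1))
      ∂(volume : Measure E).toSphere := by
  set μ : Measure E := volume
  have hmp := μ.measurePreserving_homeomorphUnitSphereProd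
  set g : sphere (0 : E) 1 × Ioi (0 : ℝ) → ℝ := fun p => f (p.2.1 • p.1.1) with hg
  have hgf : ∀ x : ({0}ᶜ : Set E), g (homeomorphUnitSphereProd E x) = f x := by
    intro x
    have hx : ‖(x : E)‖ ≠ 0 := norm_ne_zero_iff.2 x.2
    simp [hg, smul_smul, hx]
  have hint : Integrable g (μ.toSphere.prod (.volumeIoiPow (finrank ℝ E - 1))) := by
    rw [← hmp.integrable_comp_emb (Homeomorph.measurableEmbedding _)]
    have : g ∘ homeomorphUnitSphereProd E = f ∘ Subtype.val := funext hgf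
    rw [this, ← integrableOn_iff_comap_subtypeVal (measurableSet_singleton _).compl]
    exact hf.integrableOn
  calc
    ∫ x, f x ∂μ = ∫ x : ({(0)}ᶜ : Set E), f x.1 ∂(μ.comap (↑)) := by
      rw [integral_subtype_comap (measurableSet_singleton _).compl f, restrict_compl_singleton]
    _ = ∫ p, g p ∂μ.toSphere.prod (.volumeIoiPow (finrank ℝ E - 1)) := by
      rw [← hmp.integral_comp (Homeomorph.measurableEmbedding _) g]
      simp only [hgf]
    _ = ∫ θ, (∫ r, g (θ, r) ∂(.volumeIoiPow (finrank ℝ E - 1))) ∂μ.toSphere :=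
      integral_prod g hint
    _ = _ := by
      congr 1
      ext1 θ
      simp only [Measure.volumeIoiPow, ENNReal.ofReal]
      rw [integral_withDensity_eq_integral_smul,
        integral_subtype_comap measurableSet_Ioi
          fun a : ℝ ↦ Real.toNNReal (a ^ (finrank ℝ E - 1)) • f (a • θ.1),
        setIntegral_congr_fun measurableSet_Ioi fun x hx ↦ ?_]
      · rw [NNReal.smul_def, Real.coe_toNNReal _ (pow_nonneg hx.out.le _), smul_eq_mul]
      · exact (measurable_subtype_coe.pow_const _).real_toNNReal

theorem locallyIntegrable_dipole [Nontrivial E] :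
    LocallyIntegrable (fun x : E => (1 / ‖x‖ ^ finrank ℝ E) • x) := by
  have hm : AEStronglyMeasurable (fun x : E => (1 / ‖x‖ ^ finrank ℝ E) • x) volume := by
    refine Measurable.aestronglyMeasurable ?_
    fun_prop
  intro x
  refine ⟨ball 0 (‖x‖ + 1), isOpen_ball.mem_nhds (by simp), ?_⟩
  have h1 : IntegrableOn (fun x : E => (fun r : ℝ => r / r ^ finrank ℝ E) ‖x‖)
      (ball (0 : E) (‖x‖ + 1)) volume := by
    refine (integrableOn_fun_norm_addHaar volume (f := fun r : ℝ => r / r ^ finrank ℝ E)).2 ?_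
    have : IntegrableOn (fun _ : ℝ => (1 : ℝ)) (Ioo 0 (‖x‖ + 1)) := by simp
    refine this.congr_fun (fun r hr => ?_) measurableSet_Ioo
    have hr0 : r ≠ 0 := hr.1.ne'
    obtain ⟨d, hd⟩ : ∃ d, finrank ℝ E = d + 1 :=
      ⟨finrank ℝ E - 1, (Nat.sub_add_cancel Module.finrank_pos).symm⟩
    simp only [hd, Nat.add_sub_cancel, smul_eq_mul]
    field_simp
    ring
  refine Integrable.mono' h1 hm.restrict (Eventually.of_forall fun x => ?_)
  rw [norm_one_div_pow_smul]

theorem integrable_dipole_mul [Nontrivial E] (v : E) {g : E → ℝ} (hg : Continuous g)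
    (hc : HasCompactSupport g) :
    Integrable (fun x : E => ⟪v, (1 / ‖x‖ ^ finrank ℝ E) • x⟫ * g x) := by
  have h := (locallyIntegrable_dipole (E := E)).integrable_smul_left_of_hasCompactSupport hg hc
  refine ((innerSL ℝ v).integrable_comp h).congr (Eventually.of_forall fun x => ?_)
  simp only [innerSL_apply_apply, real_inner_smul_right]
  ring

/-- The divergence of `x / |x|ⁿ` is `ω_n δ_0`, tested against a `C¹` function. -/
theorem integral_dipole_fderiv_self [Nontrivial E] {ψ : E → ℝ} (hψ : ContDiff ℝ 1 ψ)
    (hc : HasCompactSupport ψ) :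
    ∫ x, 1 / ‖x‖ ^ finrank ℝ E * fderiv ℝ ψ x x =
      -((volume : Measure E).toSphere.real univ * ψ 0) := by
  set b := stdOrthonormalBasis ℝ E
  have hsum : ∀ x : E, 1 / ‖x‖ ^ finrank ℝ E * fderiv ℝ ψ x x =
      ∑ i, ⟪b i, (1 / ‖x‖ ^ finrank ℝ E) • x⟫ * fderiv ℝ ψ x (b i) := by
    intro x
    rw [clm_apply_eq_sum b, Finset.mul_sum]
    simp only [real_inner_smul_right, mul_assoc]
  have hint : Integrable fun x : E => 1 / ‖x‖ ^ finrank ℝ E * fderiv ℝ ψ x x := by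
    simp only [hsum]
    refine integrable_finsetSum _ fun i _ => integrable_dipole_mul _ ?_ ?_
    · exact (hψ.continuous_fderiv (by simp)).clm_apply continuous_const
    · exact hc.fderiv_apply ℝ _
  rw [integral_eq_integral_sphere_integral_Ioi hint]
  have hin : ∀ θ : sphere (0 : E) 1, (∫ r in Ioi (0 : ℝ), r ^ (finrank ℝ E - 1) *
      (1 / ‖r • θ.1‖ ^ finrank ℝ E * fderiv ℝ ψ (r • θ.1) (r • θ.1))) = -ψ 0 := by
    intro θ
    have hθ : ‖θ.1‖ = 1 := by simp
    have h1 : ContDiff ℝ 1 fun r : ℝ => ψ (r • θ.1) := by fun_prop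
    have h2 : HasCompactSupport fun r : ℝ => ψ (r • θ.1) := by
      obtain ⟨R, hR⟩ := hc.isCompact.isBounded.subset_closedBall 0
      refine HasCompactSupport.intro (isCompact_closedBall (0 : ℝ) R) fun r hr => ?_
      refine image_eq_zero_of_notMem_tsupport fun h => hr ?_
      have := hR h
      rw [mem_closedBall_zero_iff, norm_smul, hθ, mul_one] at this
      simpa using this
    have h3 := h2.integral_Ioi_deriv_eq h1 0
    rw [zero_smul] at h3
    rw [← h3]
    refine setIntegral_congr_fun measurableSet_Ioi fun r hr => ?_
    have hr0 : 0 < r := hr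
    have h4 : HasDerivAt (fun r : ℝ => r • θ.1) θ.1 r := by
      simpa using (hasDerivAt_id r).smul_const θ.1
    have h5 := ((hψ.differentiable (by simp) (r • θ.1)).hasFDerivAt.comp_hasDerivAt r h4).deriv
    simp only [Function.comp_def] at h5
    obtain ⟨d, hd⟩ : ∃ d, finrank ℝ E = d + 1 :=
      ⟨finrank ℝ E - 1, (Nat.sub_add_cancel Module.finrank_pos).symm⟩
    simp only [h5, norm_smul, hθ, mul_one, Real.norm_of_nonneg hr0.le, hd, Nat.add_sub_cancel,
      map_smul, smul_eq_mul]
    field_simp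
    ring
  simp only [hin]
  simp

/-- A smooth approximation of the dipole field, which is still a gradient, has a symmetric
derivative; integration by parts moves the derivative onto the test function. -/
theorem integral_regularized_dipole_comm (k : ℕ) {ε : ℝ} (hε : 0 < ε) {χ : E → ℝ}
    (hχ : ContDiff ℝ 1 χ) (hc : HasCompactSupport χ) (v w : E) :
    ∫ x, ((‖x‖ ^ 2 + ε) ^ (-(k : ℝ) / 2) * ⟪v, x⟫) * fderiv ℝ χ x w =
      ∫ x, ((‖x‖ ^ 2 + ε) ^ (-(k : ℝ) / 2) * ⟪w, x⟫) * fderiv ℝ χ x v := by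
  have hpos : ∀ x : E, ‖x‖ ^ 2 + ε ≠ 0 := fun x => by positivity
  have hder : ∀ v x : E, HasFDerivAt (fun x : E => (‖x‖ ^ 2 + ε) ^ (-(k : ℝ) / 2) * ⟪v, x⟫)
      ((‖x‖ ^ 2 + ε) ^ (-(k : ℝ) / 2) • innerSL ℝ v +
        (-(k : ℝ) * (‖x‖ ^ 2 + ε) ^ (-(k : ℝ) / 2 - 1) * ⟪v, x⟫) • innerSL ℝ x) x := by
    intro v x
    have h1 : HasFDerivAt (fun z : E => ‖z‖ ^ 2) (2 • innerSL ℝ x) x :=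
      (hasStrictFDerivAt_norm_sq x).hasFDerivAt
    have h2 : HasFDerivAt (fun z : E => ⟪v, z⟫) (innerSL ℝ v) x := (innerSL ℝ v).hasFDerivAt
    refine (((h1.add_const ε).rpow_const (p := -(k : ℝ) / 2) (Or.inl (hpos x))).mul
      h2).congr_fderiv ?_
    ext u
    simp
    ring
  have hr : ∀ p : ℝ, Continuous fun x : E => (‖x‖ ^ 2 + ε) ^ p := fun p =>
    Continuous.rpow_const (by fun_prop) fun x => Or.inl (hpos x)
  have hr1 := hr (-(k : ℝ) / 2)
  have hr2 := hr (-(k : ℝ) / 2 - 1)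
  have key : ∀ v w : E, ∫ x, ((‖x‖ ^ 2 + ε) ^ (-(k : ℝ) / 2) * ⟪v, x⟫) * fderiv ℝ χ x w =
      -∫ x, ((‖x‖ ^ 2 + ε) ^ (-(k : ℝ) / 2) * ⟪v, w⟫ +
        (-(k : ℝ) * (‖x‖ ^ 2 + ε) ^ (-(k : ℝ) / 2 - 1) * ⟪v, x⟫) * ⟪x, w⟫) * χ x := by
    intro v w
    have hf : ∀ x, fderiv ℝ (fun x : E => (‖x‖ ^ 2 + ε) ^ (-(k : ℝ) / 2) * ⟪v, x⟫) x w =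
        (‖x‖ ^ 2 + ε) ^ (-(k : ℝ) / 2) * ⟪v, w⟫ +
        (-(k : ℝ) * (‖x‖ ^ 2 + ε) ^ (-(k : ℝ) / 2 - 1) * ⟪v, x⟫) * ⟪x, w⟫ := fun x => by
      rw [(hder v x).fderiv]
      simp
    simp only [← hf]
    refine integral_mul_fderiv_eq_neg_fderiv_mul_of_integrable ?_ ?_ ?_
      (fun x _ => (hder v x).differentiableAt) fun x _ => hχ.differentiable (by simp) x
    · simp only [hf]
      refine Continuous.integrable_of_hasCompactSupport ?_ hc.mul_left
      have := hχ.continuous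
      fun_prop
    · refine Continuous.integrable_of_hasCompactSupport ?_ (hc.fderiv_apply ℝ w).mul_left
      have : Continuous fun x => fderiv ℝ χ x w :=
        (hχ.continuous_fderiv (by simp)).clm_apply continuous_const
      fun_prop
    · refine Continuous.integrable_of_hasCompactSupport ?_ hc.mul_left
      have := hχ.continuous
      fun_prop
  rw [key v w, key w v]
  congr 2
  ext x
  rw [real_inner_comm w v, real_inner_comm x w, real_inner_comm x v]
  ring

theorem tendsto_integral_regularized_dipole [Nontrivial E] {g : E → ℝ} (hg : Continuous g)
    (hc : HasCompactSupport g) (v : E) :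
    Tendsto (fun ε : ℝ => ∫ x, ((‖x‖ ^ 2 + ε) ^ (-(finrank ℝ E : ℝ) / 2) * ⟪v, x⟫) * g x)
      (𝓝[>] 0) (𝓝 (∫ x, ⟪v, (1 / ‖x‖ ^ finrank ℝ E) • x⟫ * g x)) := by
  have hne : ∀ᵐ x : E, x ≠ 0 := Measure.ae_ne volume 0
  refine tendsto_integral_filter_of_dominated_convergence
    (fun x => ‖⟪v, (1 / ‖x‖ ^ finrank ℝ E) • x⟫ * g x‖) ?_ ?_
    (integrable_dipole_mul v hg hc).norm ?_
  · filter_upwards [self_mem_nhdsWithin] with ε hε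
    refine Measurable.aestronglyMeasurable ?_
    have := hg.measurable
    fun_prop
  · filter_upwards [self_mem_nhdsWithin] with ε hε
    filter_upwards [hne] with x hx
    have hε' : (0 : ℝ) < ε := hε
    have hx0 : 0 < ‖x‖ := norm_pos_iff.2 hx
    rw [real_inner_smul_right, norm_mul, norm_mul, norm_mul, norm_mul]
    gcongr
    rw [← sq_rpow_neg_half hx0.le, Real.norm_of_nonneg (by positivity),
      Real.norm_of_nonneg (by positivity)]
    refine Real.rpow_le_rpow_of_nonpos (by positivity) (by linarith) ?_
    have : (0 : ℝ) ≤ finrank ℝ E := Nat.cast_nonneg _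
    linarith
  · filter_upwards [hne] with x hx
    have hx0 : 0 < ‖x‖ := norm_pos_iff.2 hx
    have h1 : ContinuousAt (fun ε : ℝ =>
        ((‖x‖ ^ 2 + ε) ^ (-(finrank ℝ E : ℝ) / 2) * ⟪v, x⟫) * g x) 0 := by
      have : ContinuousAt (fun ε : ℝ => (‖x‖ ^ 2 + ε) ^ (-(finrank ℝ E : ℝ) / 2)) 0 :=
        ContinuousAt.rpow_const (by fun_prop) (Or.inl (by positivity))
      fun_prop
    have h2 := h1.tendsto.mono_left (nhdsWithin_le_nhds (s := Ioi 0))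
    rwa [add_zero, sq_rpow_neg_half hx0.le, ← real_inner_smul_right] at h2

/-- The dipole field `x / |x|ⁿ` is curl-free in the sense of distributions, including at `0`. -/
theorem integral_dipole_comm [Nontrivial E] {χ : E → ℝ} (hχ : ContDiff ℝ 1 χ)
    (hc : HasCompactSupport χ) (v w : E) :
    ∫ x, ⟪v, (1 / ‖x‖ ^ finrank ℝ E) • x⟫ * fderiv ℝ χ x w =
      ∫ x, ⟪w, (1 / ‖x‖ ^ finrank ℝ E) • x⟫ * fderiv ℝ χ x v := by
  have hcont : ∀ w, Continuous fun x => fderiv ℝ χ x w := fun w =>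
    (hχ.continuous_fderiv (by simp)).clm_apply continuous_const
  have h1 := tendsto_integral_regularized_dipole (hcont w) (hc.fderiv_apply ℝ w) v
  have h2 := tendsto_integral_regularized_dipole (hcont v) (hc.fderiv_apply ℝ v) w
  refine tendsto_nhds_unique h1 (h2.congr' ?_)
  filter_upwards [self_mem_nhdsWithin] with ε hε
  exact integral_regularized_dipole_comm _ hε hχ hc w v

omit [MeasurableSpace E] [BorelSpace E] in
theorem laplacian_eq_sum_fderiv {ι : Type*} [Fintype ι] (b : OrthonormalBasis ι ℝ E) (φ : E → ℝ)
    (x : E) : (Δ φ) x = ∑ i, fderiv ℝ (fderiv ℝ φ) x (b i) (b i) := by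
  rw [InnerProductSpace.laplacian_eq_iteratedFDeriv_orthonormalBasis φ b]
  simp [iteratedFDeriv_two_apply]

omit [FiniteDimensional ℝ E] [MeasurableSpace E] [BorelSpace E] in
theorem fderiv_fderiv_apply {φ : E → ℝ} (hφ : ContDiff ℝ ∞ φ) (x u v : E) :
    fderiv ℝ (fun x => fderiv ℝ φ x u) x v = fderiv ℝ (fderiv ℝ φ) x v u := by
  have h : DifferentiableAt ℝ (fderiv ℝ φ) x :=
    (hφ.fderiv_right (m := 1) (WithTop.coe_le_coe.2 le_top)).differentiable (by simp) x
  rw [fderiv_clm_apply h (by fun_prop)]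
  simp

omit [FiniteDimensional ℝ E] [MeasurableSpace E] [BorelSpace E] in
theorem contDiff_fderiv_apply {φ : E → ℝ} (hφ : ContDiff ℝ ∞ φ) (u : E) :
    ContDiff ℝ 1 fun x => fderiv ℝ φ x u :=
  (hφ.fderiv_right (m := 1) (WithTop.coe_le_coe.2 le_top)).clm_apply contDiff_const

omit [MeasurableSpace E] [BorelSpace E] in
theorem continuous_laplacian {φ : E → ℝ} (hφ : ContDiff ℝ ∞ φ) : Continuous (Δ φ) := by
  have h1 : Continuous (fderiv ℝ (fderiv ℝ φ)) :=
    (hφ.fderiv_right (m := 1) (WithTop.coe_le_coe.2 le_top)).continuous_fderiv (by simp)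
  rw [funext (laplacian_eq_sum_fderiv (stdOrthonormalBasis ℝ E) φ)]
  fun_prop

omit [MeasurableSpace E] [BorelSpace E] in
theorem tsupport_laplacian_subset (φ : E → ℝ) : tsupport (Δ φ) ⊆ tsupport φ := by
  refine closure_minimal (fun x hx => ?_) (isClosed_tsupport φ)
  by_contra h
  refine hx ?_
  have h1 : fderiv ℝ (fderiv ℝ φ) x = 0 := image_eq_zero_of_notMem_tsupport fun h2 =>
    h (tsupport_fderiv_subset ℝ (tsupport_fderiv_subset ℝ h2))
  simp [laplacian_eq_sum_fderiv (stdOrthonormalBasis ℝ E), h1]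

omit [MeasurableSpace E] [BorelSpace E] in
theorem hasCompactSupport_laplacian {φ : E → ℝ} (hc : HasCompactSupport φ) :
    HasCompactSupport (Δ φ) :=
  hc.of_isClosed_subset (isClosed_tsupport _) (tsupport_laplacian_subset φ)

theorem integral_laplacian_eq_zero {φ : E → ℝ} (hφ : ContDiff ℝ ∞ φ) (hc : HasCompactSupport φ) :
    ∫ x, (Δ φ) x = 0 := by
  set b := stdOrthonormalBasis ℝ E
  have h1 : ∀ i, ContDiff ℝ 1 fun x => fderiv ℝ φ x (b i) := fun i => contDiff_fderiv_apply hφ _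
  have h2 : ∀ i, HasCompactSupport fun x => fderiv ℝ φ x (b i) := fun i => hc.fderiv_apply ℝ _
  have h3 : ∀ i, Continuous fun x => fderiv ℝ (fun x => fderiv ℝ φ x (b i)) x (b i) := fun i =>
    ((h1 i).continuous_fderiv (by simp)).clm_apply continuous_const
  have hint : ∀ i, Integrable fun x => fderiv ℝ (fun x => fderiv ℝ φ x (b i)) x (b i) := fun i =>
    (h3 i).integrable_of_hasCompactSupport ((h2 i).fderiv_apply ℝ _)
  simp only [laplacian_eq_sum_fderiv b, ← fderiv_fderiv_apply hφ]
  rw [integral_finsetSum _ fun i _ => hint i]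
  refine Finset.sum_eq_zero fun i _ => ?_
  have := integral_mul_fderiv_eq_neg_fderiv_mul_of_integrable (μ := (volume : Measure E))
    (f := fun _ : E => (1 : ℝ)) (g := fun x => fderiv ℝ φ x (b i)) (v := b i) (by simp)
    (by simpa using hint i)
    (by simpa using (h1 i).continuous.integrable_of_hasCompactSupport (h2 i))
    (fun x _ => by fun_prop) fun x _ => (h1 i).differentiable (by simp) x
  simpa using this

theorem integral_dipole_laplacian_zero [Nontrivial E] {φ : E → ℝ} (hφ : ContDiff ℝ ∞ φ)
    (hc : HasCompactSupport φ) (D : E) :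
    ∫ x, ⟪D, (1 / ‖x‖ ^ finrank ℝ E) • x⟫ * (Δ φ) x =
      -((volume : Measure E).toSphere.real univ * fderiv ℝ φ 0 D) := by
  set b := stdOrthonormalBasis ℝ E
  have h1 : ∀ u, ContDiff ℝ 1 fun x => fderiv ℝ φ x u := fun u => contDiff_fderiv_apply hφ u
  have h2 : ∀ u, HasCompactSupport fun x => fderiv ℝ φ x u := fun u => hc.fderiv_apply ℝ u
  have hint : ∀ v u w, Integrable fun x => ⟪v, (1 / ‖x‖ ^ finrank ℝ E) • x⟫ *
      fderiv ℝ (fun x => fderiv ℝ φ x u) x w := fun v u w =>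
    integrable_dipole_mul v (((h1 u).continuous_fderiv (by simp)).clm_apply continuous_const)
      ((h2 u).fderiv_apply ℝ w)
  rw [← integral_dipole_fderiv_self (h1 D) (h2 D)]
  simp only [laplacian_eq_sum_fderiv b, ← fderiv_fderiv_apply hφ, Finset.mul_sum]
  rw [integral_finsetSum _ fun i _ => hint _ _ _]
  simp only [fun i => integral_dipole_comm (h1 (b i)) (h2 (b i)) D (b i)]
  rw [← integral_finsetSum _ fun i _ => hint _ _ _]
  congr 1
  ext1 x
  have hsymm : IsSymmSndFDerivAt ℝ φ x :=
    hφ.contDiffAt.isSymmSndFDerivAt (by simpa using ENat.LEInfty.out)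
  simp only [fderiv_fderiv_apply hφ, real_inner_smul_right]
  rw [hsymm x D]
  rw [clm_apply_eq_sum b, Finset.mul_sum]
  simp only [mul_assoc]

/-- `Δ (D · (x - y) / |x - y|ⁿ) = ω_n div (D δ_y)` in the sense of distributions. -/
theorem integral_dipole_laplacian [Nontrivial E] {φ : E → ℝ} (hφ : ContDiff ℝ ∞ φ)
    (hc : HasCompactSupport φ) (D y : E) :
    ∫ x, ⟪D, (1 / ‖x - y‖ ^ finrank ℝ E) • (x - y)⟫ * (Δ φ) x =
      -((volume : Measure E).toSphere.real univ * fderiv ℝ φ y D) := by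
  have h1 : ContDiff ℝ ∞ fun x => φ (x + y) := by fun_prop
  have h2 : HasCompactSupport fun x => φ (x + y) :=
    hc.comp_homeomorph (Homeomorph.addRight y)
  have h3 := integral_dipole_laplacian_zero h1 h2 D
  rw [fderiv_comp_add_right, zero_add] at h3
  rw [← h3, ← integral_add_right_eq_self _ y]
  congr 1
  ext1 x
  rw [add_sub_cancel_right]
  congr 1
  simp only [InnerProductSpace.laplacian_eq_iteratedFDeriv_stdOrthonormalBasis,
    iteratedFDeriv_comp_add_right]

end Dipole

/-! ### The Green's function solves the EEG problem -/

section Existence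

variable {n : ℕ}

theorem nontrivial_euclideanSpace (hn : 1 ≤ n) : Nontrivial (EuclideanSpace ℝ (Fin n)) := by
  have : Nonempty (Fin n) := ⟨⟨0, hn⟩⟩
  infer_instance

theorem locallyIntegrable_dipole_sub (hn : 1 ≤ n) (y : EuclideanSpace ℝ (Fin n)) :
    LocallyIntegrable fun x => (1 / ‖x - y‖ ^ n) • (x - y) := by
  have := nontrivial_euclideanSpace hn
  have h := locallyIntegrable_dipole (E := EuclideanSpace ℝ (Fin n))
  rw [finrank_euclideanSpace_fin] at h
  intro x
  obtain ⟨t, ht, hi⟩ := h (x - y)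
  refine ⟨(fun x => x - y) ⁻¹' t, (continuous_sub_right y).continuousAt.preimage_mem_nhds ht, ?_⟩
  exact (measurePreserving_sub_right volume y).integrableOn_comp_preimage
    (Homeomorph.subRight y).measurableEmbedding |>.2 hi

theorem integrable_dipole_sub_mul (hn : 1 ≤ n) (v y : EuclideanSpace ℝ (Fin n))
    {g : EuclideanSpace ℝ (Fin n) → ℝ} (hg : Continuous g) (hc : HasCompactSupport g) :
    Integrable fun x => ⟪v, (1 / ‖x - y‖ ^ n) • (x - y)⟫ * g x := by
  have h := (locallyIntegrable_dipole_sub hn y).integrable_smul_left_of_hasCompactSupport hg hc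
  refine ((innerSL ℝ v).integrable_comp h).congr (Eventually.of_forall fun x => ?_)
  simp only [innerSL_apply_apply, real_inner_smul_right]
  ring

/-- As a function of `x`, `kernelFun n x z - 1` is a dipole at the reflected point. -/
theorem kernelFun_eq_dipole {z : EuclideanSpace ℝ (Fin n)} (hz : z ≠ 0)
    (x : EuclideanSpace ℝ (Fin n)) :
    kernelFun n x z = ⟪(1 / ‖z‖ ^ n) • z,
      (1 / ‖x - reflected z‖ ^ n) • (x - reflected z)⟫ + 1 := by
  have hz0 : ‖z‖ ≠ 0 := norm_ne_zero_iff.2 hz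
  have h1 := quad_rpow_smul_dir hz x ‖z‖ n
  rw [norm_smul_dir, ← norm_mul_norm_sub_reflected hz, mul_pow] at h1
  have h2 : ⟪z, x - reflected z⟫ = ⟪x, z⟫ - 1 := by
    rw [inner_sub_right, reflected, real_inner_smul_right, real_inner_self_eq_norm_sq,
      real_inner_comm, inv_mul_cancel₀ (pow_ne_zero 2 hz0)]
  rw [kernelFun, h1, real_inner_smul_left, real_inner_smul_right, h2]
  simp only [one_div, mul_inv]
  ring

/-- The reflected point lies outside the ball, so the dipole there is harmonic in the ball. -/
theorem integral_kernelFun_mul_laplacian (hn : 1 ≤ n) {z : EuclideanSpace ℝ (Fin n)}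
    (hz : ‖z‖ < 1) {φ : EuclideanSpace ℝ (Fin n) → ℝ} (hφ : ContDiff ℝ ∞ φ)
    (hc : HasCompactSupport φ) (hs : tsupport φ ⊆ ball 0 1) :
    ∫ x, kernelFun n x z * (Δ φ) x = 0 := by
  have := nontrivial_euclideanSpace hn
  rcases eq_or_ne z 0 with rfl | hz0
  · simp [kernelFun_zero_right]
  have hz1 : 0 < ‖z‖ := norm_pos_iff.2 hz0
  simp only [kernelFun_eq_dipole hz0, add_mul, one_mul]
  rw [integral_add (integrable_dipole_sub_mul hn _ _ (continuous_laplacian hφ)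
    (hasCompactSupport_laplacian hc)) ((continuous_laplacian hφ).integrable_of_hasCompactSupport
    (hasCompactSupport_laplacian hc)), integral_laplacian_eq_zero hφ hc]
  have h := integral_dipole_laplacian hφ hc ((1 / ‖z‖ ^ n) • z) (reflected z)
  rw [finrank_euclideanSpace_fin] at h
  have h0 : fderiv ℝ φ (reflected z) = 0 := by
    refine image_eq_zero_of_notMem_tsupport fun h => ?_
    have h1 := hs (tsupport_fderiv_subset ℝ h)
    rw [mem_ball_zero_iff, reflected, norm_smul, Real.norm_of_nonneg (by positivity)] at h1
    have h2 : (‖z‖ ^ 2)⁻¹ * ‖z‖ = ‖z‖⁻¹ := by field_simp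
    rw [h2] at h1
    have := one_lt_inv_iff₀.2 ⟨hz1, hz⟩
    linarith
  rw [h, h0]
  simp

/-- The identity `∫ kernelFun n x z Δφ(x) dx = 0`, differentiated in `z` in the direction `D`. -/
theorem integral_inner_kernelGrad_mul_laplacian (hn : 1 ≤ n) (D : EuclideanSpace ℝ (Fin n))
    {z : EuclideanSpace ℝ (Fin n)} (hz : ‖z‖ < 1) {φ : EuclideanSpace ℝ (Fin n) → ℝ}
    (hφ : ContDiff ℝ ∞ φ) (hc : HasCompactSupport φ) (hs : tsupport φ ⊆ ball 0 1) :
    ∫ x in tsupport φ, ⟪D, kernelGrad n x z⟫ * (Δ φ) x = 0 := by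
  have hq : ∀ p ∈ ball (0 : EuclideanSpace ℝ (Fin n)) 1 ×ˢ tsupport φ, 0 < quad p.2 p.1 :=
    fun p hp => quad_pos (norm_mul_norm_lt_one (ball_subset_closedBall (hs hp.2)) hp.1)
  have hΔ := continuous_laplacian hφ
  have hF : ContinuousOn (fun p : EuclideanSpace ℝ (Fin n) × EuclideanSpace ℝ (Fin n) =>
      kernelFun n p.2 p.1 * (Δ φ) p.2) (ball 0 1 ×ˢ tsupport φ) := by
    intro p hp
    refine ContinuousAt.continuousWithinAt ?_
    have h1 := ContinuousAt.comp (f := fun p : EuclideanSpace ℝ (Fin n) ×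
      EuclideanSpace ℝ (Fin n) => (p.2, p.1)) (x := p) (continuousAt_kernelFun n (hq p hp))
      (by fun_prop)
    simp only [Function.comp_def] at h1
    fun_prop
  have hG : ContinuousOn (fun p : EuclideanSpace ℝ (Fin n) × EuclideanSpace ℝ (Fin n) =>
      (Δ φ) p.2 • innerSL ℝ (kernelGrad n p.2 p.1)) (ball 0 1 ×ˢ tsupport φ) := by
    intro p hp
    refine ContinuousAt.continuousWithinAt ?_
    have h1 := ContinuousAt.comp (f := fun p : EuclideanSpace ℝ (Fin n) ×
      EuclideanSpace ℝ (Fin n) => (p.2, p.1)) (x := p)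
      (contDiffAt_kernelGrad n (hq p hp)).continuousAt (by fun_prop)
    simp only [Function.comp_def] at h1
    fun_prop
  have hz' : z ∈ ball (0 : EuclideanSpace ℝ (Fin n)) 1 := by simpa using hz
  have key := hasFDerivAt_setIntegral_of_isCompact
    (μ := (volume : Measure (EuclideanSpace ℝ (Fin n))))
    (f := fun z x => kernelFun n x z * (Δ φ : EuclideanSpace ℝ (Fin n) → ℝ) x)
    (f' := fun z x => (Δ φ : EuclideanSpace ℝ (Fin n) → ℝ) x • innerSL ℝ (kernelGrad n x z))
    (U := ball 0 1) (K := tsupport φ) isOpen_ball hc.isCompact ?_ ?_ hG hz'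
  · have h0 : (fun z => ∫ x in tsupport φ, kernelFun n x z * (Δ φ) x) =ᶠ[𝓝 z] fun _ => 0 := by
      filter_upwards [isOpen_ball.mem_nhds hz'] with w hw
      rw [setIntegral_eq_integral_of_forall_compl_eq_zero]
      · exact integral_kernelFun_mul_laplacian hn (by simpa using hw) hφ hc hs
      · intro x hx
        rw [image_eq_zero_of_notMem_tsupport fun h => hx (tsupport_laplacian_subset φ h), mul_zero]
    have h1 := key.unique ((hasFDerivAt_const (0 : ℝ) z).congr_of_eventuallyEq h0)
    have h2 := DFunLike.congr_fun h1 D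
    rw [ContinuousLinearMap.integral_apply] at h2
    · simp only [_root_.smul_apply, innerSL_apply_apply, smul_eq_mul,
        _root_.zero_apply] at h2
      rw [← h2]
      congr 1
      ext1 x
      rw [real_inner_comm, mul_comm]
    · exact (hG.comp (f := fun x => (z, x)) (by fun_prop)
        fun x hx => ⟨hz', hx⟩).integrableOn_compact hc.isCompact
  · exact fun w hw => (hF.comp (f := fun x => (w, x)) (by fun_prop)
        fun x hx => ⟨hw, hx⟩).integrableOn_compact hc.isCompact
  · filter_upwards [ae_restrict_mem hc.isCompact.measurableSet] with x hx w hw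
    exact (hasFDerivAt_kernelFun n (hq (w, x) ⟨hw, hx⟩)).mul_const _

theorem integral_inner_regularPart_mul_laplacian (hn : 1 ≤ n) (D : EuclideanSpace ℝ (Fin n))
    {z : EuclideanSpace ℝ (Fin n)} (hz : ‖z‖ < 1) {φ : EuclideanSpace ℝ (Fin n) → ℝ}
    (hφ : ContDiff ℝ ∞ φ) (hc : HasCompactSupport φ) (hs : tsupport φ ⊆ ball 0 1) :
    ∫ x, ⟪D, regularPart n x z⟫ * (Δ φ) x = 0 := by
  have hz' : z ∈ ball (0 : EuclideanSpace ℝ (Fin n)) 1 := by simpa using hz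
  have hxz : ∀ x ∈ tsupport φ, ‖x‖ * ‖z‖ < 1 := fun x hx =>
    norm_mul_norm_lt_one (ball_subset_closedBall (hs hx)) hz'
  have hΔ := continuous_laplacian hφ
  rw [← setIntegral_eq_integral_of_forall_compl_eq_zero (s := tsupport φ)]
  swap
  · intro x hx
    rw [image_eq_zero_of_notMem_tsupport fun h => hx (tsupport_laplacian_subset φ h), mul_zero]
  have h1 : ∀ x ∈ tsupport φ, ⟪D, regularPart n x z⟫ * (Δ φ) x =
      ∫ t in Icc (0 : ℝ) 1, ⟪D, kernelGrad n x (t • z)⟫ * (Δ φ) x := by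
    intro x hx
    rw [integral_mul_const, regularPart, intervalIntegral_zero_one_eq]
    congr 1
    exact ((innerSL ℝ D).integral_comp_comm
      (continuousOn_kernelGrad_section n (hxz x hx)).integrableOn_Icc).symm
  rw [setIntegral_congr_fun hc.isCompact.measurableSet h1, integral_integral_swap]
  · refine (setIntegral_congr_fun measurableSet_Icc fun t ht => ?_).trans (integral_zero _ _)
    refine integral_inner_kernelGrad_mul_laplacian hn D ?_ hφ hc hs
    rw [norm_smul, Real.norm_of_nonneg ht.1]
    nlinarith [ht.2, norm_nonneg z]
  · rw [Measure.prod_restrict]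
    refine ContinuousOn.integrableOn_compact (hc.isCompact.prod isCompact_Icc) ?_
    have h2 : ContinuousOn (fun p : EuclideanSpace ℝ (Fin n) × ℝ => kernelGrad n p.1 (p.2 • z))
        (tsupport φ ×ˢ Icc 0 1) :=
      (continuousOn_kernelGrad_smul n).comp
        (f := fun p : EuclideanSpace ℝ (Fin n) × ℝ => ((p.1, z), p.2)) (by fun_prop)
        fun p hp => ⟨hxz p.1 hp.1, hp.2⟩
    have h3 : ContinuousOn (fun p : EuclideanSpace ℝ (Fin n) × ℝ => (Δ φ) p.1)
        (tsupport φ ×ˢ Icc 0 1) := (hΔ.comp continuous_fst).continuousOn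
    exact (continuousOn_const.inner h2).mul h3

theorem contDiffOn_dipole {E : Type*} [NormedAddCommGroup E] [InnerProductSpace ℝ E] (k : ℕ)
    (z : E) : ContDiffOn ℝ 1 (fun x => (1 / ‖x - z‖ ^ k) • (x - z)) {z}ᶜ := by
  intro x hx
  have h0 : x - z ≠ 0 := sub_ne_zero.2 hx
  have h1 : ContDiffAt ℝ 1 (fun x => ‖x - z‖) x := ContDiffAt.norm ℝ (by fun_prop) h0
  have h2 : ‖x - z‖ ^ k ≠ 0 := pow_ne_zero _ (norm_ne_zero_iff.2 h0)
  refine ContDiffAt.contDiffWithinAt ?_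
  fun_prop (disch := exact h2)

/-- On the unit sphere the radial derivative of the dipole field is the kernel, so that it cancels
the radial derivative of the regular part. -/
theorem fderiv_dipole_self_of_norm_eq_one {E : Type*} [NormedAddCommGroup E]
    [InnerProductSpace ℝ E] (k : ℕ) {x z : E} (hx : ‖x‖ = 1) (hxz : x ≠ z) :
    fderiv ℝ (fun x => (1 / ‖x - z‖ ^ k) • (x - z)) x x = kernelGrad k x z := by
  have h0 : 0 < ‖x - z‖ := norm_pos_iff.2 (sub_ne_zero.2 hxz)
  have h1 : HasFDerivAt (fun x : E => x - z) (ContinuousLinearMap.id ℝ E) x :=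
    (hasFDerivAt_id x).sub_const z
  have h2 := (hasStrictFDerivAt_norm_sq (x - z)).hasFDerivAt.comp x h1
  have h3 : HasFDerivAt (fun x : E => ((‖x - z‖ ^ 2) ^ (-(k : ℝ) / 2)) • (x - z)) _ x :=
    (h2.rpow_const (p := -(k : ℝ) / 2) (Or.inl (by simpa using h0.ne'))).smul h1
  have he : (fun x : E => (1 / ‖x - z‖ ^ k) • (x - z)) =
      fun x => ((‖x - z‖ ^ 2) ^ (-(k : ℝ) / 2)) • (x - z) := by
    ext1 x
    rw [sq_rpow_neg_half (norm_nonneg _)]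
  have hq : quad x z = ‖x - z‖ ^ 2 := by
    rw [quad, norm_sub_sq_real, hx]
    ring
  rw [he, h3.fderiv, kernelGrad, hq, hx]
  simp [real_inner_comm z x, hx]
  module

theorem contDiffOn_green (D : EuclideanSpace ℝ (Fin n)) (z : EuclideanSpace ℝ (Fin n)) :
    ContDiffOn ℝ 1 (fun x => 1 / surfaceArea n *
      ⟪D, (1 / ‖x - z‖ ^ n) • (x - z) - regularPart n x z⟫)
      ({x | ‖x‖ * ‖z‖ < 1} ∩ {z}ᶜ) := by
  refine contDiffOn_const.mul (contDiffOn_const.inner ℝ ?_)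
  exact ((contDiffOn_dipole n z).mono inter_subset_right).sub
    ((contDiffOn_regularPart n z).mono inter_subset_left)

theorem uniqueDiffOn_closedBall :
    UniqueDiffOn ℝ (closedBall (0 : EuclideanSpace ℝ (Fin n)) 1) :=
  uniqueDiffOn_convex (convex_closedBall _ _)
    ⟨0, ball_subset_interior_closedBall (mem_ball_self one_pos)⟩

/-- The values of `u` at the pole and outside the closed ball are arbitrary. -/
theorem isEEGSolution_of_eq_eegGreen_add (hn : 1 ≤ n) {D z : EuclideanSpace ℝ (Fin n)}
    (hz : z ∈ ball (0 : EuclideanSpace ℝ (Fin n)) 1) {u : EuclideanSpace ℝ (Fin n) → ℝ} {C : ℝ}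
    (hu : ∀ x ∈ closedBall (0 : EuclideanSpace ℝ (Fin n)) 1 \ {z},
      u x = eegGreen n D z x + C) : IsEEGSolution n D z u := by
  have := nontrivial_euclideanSpace hn
  set g : EuclideanSpace ℝ (Fin n) → ℝ := fun x => 1 / surfaceArea n *
      ⟪D, (1 / ‖x - z‖ ^ n) • (x - z) - regularPart n x z⟫ + C with hg
  have hz1 : ‖z‖ < 1 := by simpa using hz
  have hω := (surfaceArea_pos hn).ne'
  have hug : ∀ x ∈ closedBall (0 : EuclideanSpace ℝ (Fin n)) 1 \ {z}, u x = g x := by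
    intro x hx
    rw [hu x hx, eegGreen_eq D (norm_mul_norm_lt_one hx.1 hz)]
  have hU : IsOpen {x : EuclideanSpace ℝ (Fin n) | ‖x‖ * ‖z‖ < 1} :=
    isOpen_lt (by fun_prop) continuous_const
  have hsub : closedBall (0 : EuclideanSpace ℝ (Fin n)) 1 \ {z} ⊆
      {x | ‖x‖ * ‖z‖ < 1} ∩ {z}ᶜ := fun x hx => ⟨norm_mul_norm_lt_one hx.1 hz, hx.2⟩
  have hne : ∀ᵐ x : EuclideanSpace ℝ (Fin n), x ≠ z := Measure.ae_ne volume z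
  refine ⟨⟨?_, ?_⟩, ?_, ?_⟩
  · have h1 : LocallyIntegrableOn g (ball 0 1) volume := by
      have hd : LocallyIntegrableOn (fun x => 1 / surfaceArea n *
          ⟪D, (1 / ‖x - z‖ ^ n) • (x - z)⟫) (ball 0 1) volume := fun x _ => by
        obtain ⟨t, ht, hi⟩ := locallyIntegrable_dipole_sub hn z x
        exact ⟨t, mem_nhdsWithin_of_mem_nhds ht, ((innerSL ℝ D).integrable_comp hi).const_mul _⟩
      have hr : ContinuousOn (fun x => 1 / surfaceArea n * ⟪D, regularPart n x z⟫ - C)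
          (ball (0 : EuclideanSpace ℝ (Fin n)) 1) :=
        (continuousOn_const.mul (continuousOn_const.inner
          ((contDiffOn_regularPart n z).continuousOn.mono
          fun x hx => norm_mul_norm_lt_one (ball_subset_closedBall hx) hz))).sub continuousOn_const
      convert hd.sub (hr.locallyIntegrableOn measurableSet_ball) using 1
      ext1 x
      simp only [hg, inner_sub_right, Pi.sub_apply]
      ring
    intro x hx
    obtain ⟨t, ht, hi⟩ := h1 x hx
    obtain ⟨V, hV, hxV, hVt⟩ := mem_nhdsWithin.1 ht
    refine ⟨V ∩ ball 0 1, mem_nhdsWithin.2 ⟨V, hV, hxV, le_rfl⟩, ?_⟩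
    refine (hi.mono_set hVt).congr ?_
    filter_upwards [ae_restrict_mem (hV.measurableSet.inter measurableSet_ball),
      ae_restrict_of_ae hne] with y hy hyz
    exact (hug y ⟨ball_subset_closedBall hy.2, hyz⟩).symm
  · intro φ hφ hc hs
    have hΔ := continuous_laplacian hφ
    have hΔc := hasCompactSupport_laplacian hc
    have h1 : ∫ x, u x * (Δ φ) x = ∫ x, g x * (Δ φ) x := by
      refine integral_congr_ae ?_
      filter_upwards [hne] with x hx
      by_cases hxs : x ∈ tsupport φ
      · rw [hug x ⟨ball_subset_closedBall (hs hxs), hx⟩]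
      · rw [image_eq_zero_of_notMem_tsupport fun h => hxs (tsupport_laplacian_subset φ h),
          mul_zero, mul_zero]
    have i1 := integrable_dipole_sub_mul hn D z hΔ hΔc
    have i2 : Integrable fun x => ⟪D, regularPart n x z⟫ * (Δ φ) x := by
      refine (integrableOn_iff_integrable_of_support_subset (s := tsupport φ) fun x hx =>
        tsupport_laplacian_subset φ (subset_tsupport _ (right_ne_zero_of_mul hx))).1 ?_
      refine ContinuousOn.integrableOn_compact hc.isCompact ?_
      refine ContinuousOn.mul (continuousOn_const.inner
        ((contDiffOn_regularPart n z).continuousOn.mono fun x hx => ?_)) hΔ.continuousOn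
      exact norm_mul_norm_lt_one (ball_subset_closedBall (hs hx)) hz
    have i3 := hΔ.integrable_of_hasCompactSupport (μ := volume) hΔc
    have h2 : ∀ x, g x * (Δ φ) x = 1 / surfaceArea n *
        (⟪D, (1 / ‖x - z‖ ^ n) • (x - z)⟫ * (Δ φ) x - ⟪D, regularPart n x z⟫ * (Δ φ) x)
        + C * (Δ φ) x := by
      intro x
      simp only [hg, inner_sub_right]
      ring
    have h3 := integral_dipole_laplacian hφ hc D z
    rw [finrank_euclideanSpace_fin] at h3
    rw [setIntegral_eq_integral_of_forall_compl_eq_zero, h1]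
    swap
    · intro x hx
      rw [image_eq_zero_of_notMem_tsupport fun h => hx (hs (tsupport_laplacian_subset φ h)),
        mul_zero]
    simp only [h2]
    have i12 : Integrable fun x => ⟪D, (1 / ‖x - z‖ ^ n) • (x - z)⟫ * (Δ φ) x -
        ⟪D, regularPart n x z⟫ * (Δ φ) x := i1.sub i2
    rw [integral_add (i12.const_mul _) (i3.const_mul C), integral_const_mul,
      integral_const_mul, integral_sub i1 i2, integral_laplacian_eq_zero hφ hc,
      integral_inner_regularPart_mul_laplacian hn D hz1 hφ hc hs, h3, real_inner_comm,
      inner_gradient_left]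
    change 1 / surfaceArea n * (-(surfaceArea n * _) - 0) + C * 0 = _
    field_simp
    ring
  · exact (((contDiffOn_green D z).mono hsub).add contDiffOn_const).congr hug
  · intro x hx
    have hx1 : ‖x‖ = 1 := by simpa using hx
    have hxc : x ∈ closedBall (0 : EuclideanSpace ℝ (Fin n)) 1 := sphere_subset_closedBall hx
    have hxz : x ≠ z := by
      rintro rfl
      linarith
    have hxz1 : ‖x‖ * ‖z‖ < 1 := norm_mul_norm_lt_one hxc hz
    have he : u =ᶠ[𝓝[closedBall 0 1] x] g := by
      filter_upwards [self_mem_nhdsWithin,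
        mem_nhdsWithin_of_mem_nhds (isOpen_compl_singleton.mem_nhds hxz)] with y hy hyz
      exact hug y ⟨hy, hyz⟩
    have hd1 : DifferentiableAt ℝ (fun x => (1 / ‖x - z‖ ^ n) • (x - z)) x :=
      ((contDiffOn_dipole n z).contDiffAt
        (isOpen_compl_singleton.mem_nhds hxz)).differentiableAt (by simp)
    have hd2 : DifferentiableAt ℝ (fun x => regularPart n x z) x :=
      ((contDiffOn_regularPart n z).contDiffAt (hU.mem_nhds hxz1)).differentiableAt (by simp)
    have hd : HasFDerivAt g ((1 / surfaceArea n) • (innerSL ℝ D).comp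
        (fderiv ℝ (fun x => (1 / ‖x - z‖ ^ n) • (x - z)) x
          - fderiv ℝ (fun x => regularPart n x z) x)) x :=
      (((innerSL ℝ D).hasFDerivAt.comp x (hd1.hasFDerivAt.sub hd2.hasFDerivAt)).const_mul
        (1 / surfaceArea n)).add_const C
    rw [he.fderivWithin_eq_of_mem hxc, hd.hasFDerivWithinAt.fderivWithin
      (uniqueDiffOn_closedBall x hxc)]
    simp only [_root_.smul_apply, ContinuousLinearMap.comp_apply, _root_.sub_apply,
      fderiv_dipole_self_of_norm_eq_one n hx1 hxz, fderiv_regularPart_self n hxz1, sub_self,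
      map_zero, smul_zero]

end Existence

/-! ### The mean value property of weakly harmonic functions -/

section MeanValue

/-- A primitive of `bumpProfile`, supported in `(-∞, 1]`. -/
def bumpPrimitive (u : ℝ) : ℝ := -expNegInvGlue (1 - u)

/-- A smooth nonnegative function on `ℝ` that is positive exactly on `(-∞, 1)`. -/
def bumpProfile (u : ℝ) : ℝ := ((1 - u)⁻¹) ^ 2 * expNegInvGlue (1 - u)

theorem hasDerivAt_bumpPrimitive (u : ℝ) : HasDerivAt bumpPrimitive (bumpProfile u) u := by
  have h1 := expNegInvGlue.hasDerivAt_polynomial_eval_inv_mul 1 (1 - u)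
  simp only [Polynomial.eval_one, one_mul, Polynomial.derivative_one, sub_zero, mul_one,
    Polynomial.eval_pow, Polynomial.eval_X] at h1
  have h2 := (h1.comp u ((hasDerivAt_id u).const_sub 1)).neg
  refine h2.congr_deriv ?_
  simp [bumpProfile]

theorem contDiff_bumpPrimitive : ContDiff ℝ ∞ bumpPrimitive := by
  have h : ContDiff ℝ ∞ expNegInvGlue := expNegInvGlue.contDiff
  unfold bumpPrimitive
  fun_prop

theorem contDiff_bumpProfile : ContDiff ℝ ∞ bumpProfile := by
  have h : bumpProfile = deriv bumpPrimitive :=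
    funext fun u => (hasDerivAt_bumpPrimitive u).deriv.symm
  rw [h]
  exact (contDiff_infty_iff_deriv.1 contDiff_bumpPrimitive).2

theorem hasDerivAt_bumpProfile (u : ℝ) : HasDerivAt bumpProfile (deriv bumpProfile u) u :=
  (contDiff_bumpProfile.differentiable (by simp) u).hasDerivAt

theorem continuous_deriv_bumpProfile : Continuous (deriv bumpProfile) :=
  contDiff_bumpProfile.continuous_deriv (by simp)

theorem bumpProfile_nonneg (u : ℝ) : 0 ≤ bumpProfile u :=
  mul_nonneg (sq_nonneg _) (expNegInvGlue.nonneg _)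

theorem bumpProfile_pos {u : ℝ} (hu : u < 1) : 0 < bumpProfile u := by
  have h : 0 < 1 - u := by linarith
  exact mul_pos (by positivity) (expNegInvGlue.pos_of_pos h)

theorem bumpProfile_eq_zero {u : ℝ} (hu : 1 ≤ u) : bumpProfile u = 0 := by
  rw [bumpProfile, expNegInvGlue.zero_of_nonpos (by linarith), mul_zero]

theorem bumpPrimitive_eq_zero {u : ℝ} (hu : 1 ≤ u) : bumpPrimitive u = 0 := by
  rw [bumpPrimitive, expNegInvGlue.zero_of_nonpos (by linarith), neg_zero]

open Module (finrank)

variable {E : Type*} [NormedAddCommGroup E] [InnerProductSpace ℝ E] [FiniteDimensional ℝ E]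

theorem laplacian_bumpPrimitive (c : ℝ) (x y : E) :
    (Δ fun y => bumpPrimitive (c ^ 2 * ‖x - y‖ ^ 2)) y =
      c ^ 2 * (2 * finrank ℝ E * bumpProfile (c ^ 2 * ‖x - y‖ ^ 2)
        + 4 * (c ^ 2 * ‖x - y‖ ^ 2) * deriv bumpProfile (c ^ 2 * ‖x - y‖ ^ 2)) := by
  set b := stdOrthonormalBasis ℝ E
  obtain ⟨L, hL⟩ : ∃ L : E →L[ℝ] E →L[ℝ] ℝ, ∀ u v, L u v = ⟪u, v⟫ :=
    ⟨innerSL ℝ, fun _ _ => rfl⟩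
  have hs : ∀ y : E, HasFDerivAt (fun y : E => c ^ 2 * ‖x - y‖ ^ 2)
      ((2 * c ^ 2) • L (y - x)) y := by
    intro y
    have h1 := (hasStrictFDerivAt_norm_sq (x - y)).hasFDerivAt.comp y
      ((hasFDerivAt_id y).const_sub x)
    refine (h1.const_mul (c ^ 2)).congr_fderiv ?_
    ext v
    simp [hL]
    ring
  have h1 : fderiv ℝ (fun y => bumpPrimitive (c ^ 2 * ‖x - y‖ ^ 2)) = fun y : E =>
      (2 * c ^ 2 * bumpProfile (c ^ 2 * ‖x - y‖ ^ 2)) • L (y - x) := by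
    ext1 y
    have h : HasFDerivAt (fun y => bumpPrimitive (c ^ 2 * ‖x - y‖ ^ 2)) _ y :=
      (hasDerivAt_bumpPrimitive _).comp_hasFDerivAt y (hs y)
    rw [h.fderiv, smul_smul]
    congr 1
    ring
  have h2 : HasFDerivAt (fun y : E => L (y - x)) L y :=
    L.hasFDerivAt.comp y ((hasFDerivAt_id y).sub_const x)
  have h3 := ((((hasDerivAt_bumpProfile _).comp_hasFDerivAt y (hs y)).const_mul
    (2 * c ^ 2)).smul h2).fderiv
  simp only [laplacian_eq_sum_fderiv b, h1]
  have h4 : fderiv ℝ (fun y : E =>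
      (2 * c ^ 2 * bumpProfile (c ^ 2 * ‖x - y‖ ^ 2)) • L (y - x)) y = _ := h3
  have h5 : ∑ i, ⟪y - x, b i⟫ ^ 2 = ‖x - y‖ ^ 2 := by
    rw [b.sum_sq_inner_left, norm_sub_rev]
  have h6 : ∀ i, fderiv ℝ (fun y : E =>
      (2 * c ^ 2 * bumpProfile (c ^ 2 * ‖x - y‖ ^ 2)) • L (y - x)) y (b i) (b i) =
      2 * c ^ 2 * bumpProfile (c ^ 2 * ‖x - y‖ ^ 2) +
        4 * c ^ 4 * deriv bumpProfile (c ^ 2 * ‖x - y‖ ^ 2) * ⟪y - x, b i⟫ ^ 2 := by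
    intro i
    rw [h4]
    have hb : ⟪b i, b i⟫ = 1 := by simp
    simp only [Function.comp_apply, _root_.add_apply, _root_.smul_apply,
      ContinuousLinearMap.smulRight_apply, hL, smul_eq_mul, hb]
    ring
  simp only [h6]
  rw [Finset.sum_add_distrib, Finset.sum_const, ← Finset.mul_sum, h5]
  simp
  ring

theorem hasDerivAt_pow_mul_bumpProfile {c : ℝ} (hc : c ≠ 0) (x y : E) :
    HasDerivAt (fun c : ℝ => c ^ finrank ℝ E * bumpProfile (c ^ 2 * ‖x - y‖ ^ 2))
      (c ^ finrank ℝ E / (2 * c ^ 3) *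
        (Δ fun y => bumpPrimitive (c ^ 2 * ‖x - y‖ ^ 2)) y) c := by
  have h1 : HasDerivAt (fun c : ℝ => c ^ 2 * ‖x - y‖ ^ 2) (2 * c * ‖x - y‖ ^ 2) c := by
    simpa using (hasDerivAt_pow 2 c).mul_const (‖x - y‖ ^ 2)
  have h2 := (hasDerivAt_pow (finrank ℝ E) c).mul ((hasDerivAt_bumpProfile _).comp c h1)
  refine h2.congr_deriv ?_
  rw [laplacian_bumpPrimitive]
  simp only [Function.comp_def]
  rcases Nat.eq_zero_or_pos (finrank ℝ E) with h0 | h0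
  · rw [h0]
    field_simp
    simp
    ring
  · obtain ⟨d, hd⟩ : ∃ d, finrank ℝ E = d + 1 := ⟨finrank ℝ E - 1, (Nat.sub_add_cancel h0).symm⟩
    rw [hd]
    simp only [Nat.add_sub_cancel]
    field_simp
    ring

theorem continuousOn_deriv_pow_mul_bumpProfile (x : E) :
    ContinuousOn (fun p : ℝ × E => p.1 ^ finrank ℝ E / (2 * p.1 ^ 3) *
        (Δ fun y => bumpPrimitive (p.1 ^ 2 * ‖x - y‖ ^ 2)) p.2) {p | p.1 ≠ 0} := by
  simp only [laplacian_bumpPrimitive]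
  have h1 := contDiff_bumpProfile.continuous
  have h2 := continuous_deriv_bumpProfile
  intro p hp
  have hp' : 2 * p.1 ^ 3 ≠ 0 := mul_ne_zero two_ne_zero (pow_ne_zero 3 hp)
  refine ContinuousAt.continuousWithinAt ?_
  fun_prop (disch := exact hp')

omit [InnerProductSpace ℝ E] [FiniteDimensional ℝ E] in
theorem one_le_of_notMem_closedBall {c c' : ℝ} (hc : 0 < c) (hcc' : c ≤ c') {x y : E}
    (hy : y ∉ closedBall x (1 / c)) : 1 ≤ c' ^ 2 * ‖x - y‖ ^ 2 := by
  rw [mem_closedBall, dist_eq_norm, not_le, norm_sub_rev, div_lt_iff₀ hc] at hy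
  have h1 : 1 ≤ c' * ‖x - y‖ := by
    have : ‖x - y‖ * c ≤ c' * ‖x - y‖ := by
      rw [mul_comm]
      gcongr
    linarith
  rw [← mul_pow]
  exact one_le_pow₀ h1

omit [InnerProductSpace ℝ E] [FiniteDimensional ℝ E] in
theorem closedBall_subset_ball_zero_one {c : ℝ} (hc0 : 0 < c) {x : E} (hc : 1 < c * (1 - ‖x‖)) :
    closedBall x (1 / c) ⊆ ball 0 1 := by
  refine closedBall_subset_ball' ?_
  rw [dist_zero_right, div_add' _ _ _ hc0.ne', div_lt_one hc0]
  linarith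

variable [MeasurableSpace E] [BorelSpace E]

/-- A locally integrable function on the open unit ball that is harmonic in the sense of
distributions. -/
def IsWeaklyHarmonic (w : E → ℝ) : Prop :=
  LocallyIntegrableOn w (ball 0 1) volume ∧
  ∀ φ : E → ℝ, ContDiff ℝ ∞ φ → HasCompactSupport φ → tsupport φ ⊆ ball 0 1 →
    ∫ x in ball (0 : E) 1, w x * (Δ φ) x = 0

theorem IsWeaklyHarmonic.congr_ae {w v : E → ℝ} (hw : IsWeaklyHarmonic w) (h : w =ᵐ[volume] v) :
    IsWeaklyHarmonic v := by
  refine ⟨fun x hx => ?_, fun φ hφ hc hs => ?_⟩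
  · obtain ⟨t, ht, hi⟩ := hw.1 x hx
    exact ⟨t, ht, hi.congr (ae_restrict_of_ae h)⟩
  · rw [← hw.2 φ hφ hc hs]
    refine integral_congr_ae (ae_restrict_of_ae ?_)
    filter_upwards [h] with x hx
    rw [hx]

/-- The average over a ball about `x` of radius `1 / c` with respect to the (not normalized) radial
weight `bumpProfile`. The ball is meant to lie in the unit ball, which is the domain of
integration so that the values of `w` outside are irrelevant. -/
def bumpAverage (w : E → ℝ) (x : E) (c : ℝ) : ℝ :=
  ∫ y in ball (0 : E) 1, c ^ finrank ℝ E * bumpProfile (c ^ 2 * ‖x - y‖ ^ 2) * w y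

theorem bumpAverage_eq_setIntegral {w : E → ℝ} {x : E} {c : ℝ} {K : Set E}
    (hsub : K ⊆ ball 0 1) (h : ∀ y ∉ K, 1 ≤ c ^ 2 * ‖x - y‖ ^ 2) :
    bumpAverage w x c =
      ∫ y in K, c ^ finrank ℝ E * bumpProfile (c ^ 2 * ‖x - y‖ ^ 2) * w y := by
  rw [bumpAverage, setIntegral_eq_of_subset_of_forall_sdiff_eq_zero measurableSet_ball hsub]
  intro y hy
  rw [bumpProfile_eq_zero (h y hy.2), mul_zero, zero_mul]

/-- The average does not depend on the radius: the `c`-derivative of the weight is a multiple of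
the Laplacian of a test function. -/
theorem IsWeaklyHarmonic.hasDerivAt_bumpAverage {w : E → ℝ} (hw : IsWeaklyHarmonic w) {x : E}
    {c : ℝ} (hx : ‖x‖ < 1) (hc : 1 < c * (1 - ‖x‖)) : HasDerivAt (bumpAverage w x) 0 c := by
  have hx' : 0 < 1 - ‖x‖ := by linarith
  have hc1 : 1 / (1 - ‖x‖) < c := by rwa [div_lt_iff₀ hx']
  -- for all parameters above `a` the weights are supported in one compact subset of the unit ball
  obtain ⟨a, ha1, hac⟩ := exists_between hc1
  have ha0 : 0 < a := lt_trans (by positivity) ha1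
  have hc0 : 0 < c := ha0.trans hac
  rw [div_lt_iff₀ hx'] at ha1
  set K := closedBall x (1 / a) with hK
  have hKb : K ⊆ ball 0 1 := closedBall_subset_ball_zero_one ha0 ha1
  have hKc : IsCompact K := isCompact_closedBall _ _
  have hwK : IntegrableOn w K := (hw.1.mono_set hKb).integrableOn_isCompact hKc
  obtain ⟨C, hC⟩ := ((isCompact_Icc (a := a) (b := c + 1)).prod hKc).exists_bound_of_continuousOn
    ((continuousOn_deriv_pow_mul_bumpProfile x).mono fun p hp => (ha0.trans_le hp.1.1).ne')
  have hbc := contDiff_bumpProfile.continuous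
  have hmeas : ∀ g : E → ℝ, Continuous g → AEStronglyMeasurable (fun y => g y * w y)
      (volume.restrict K) := fun g hg => hg.aestronglyMeasurable.mul hwK.aestronglyMeasurable
  have hwI : ∀ g : E → ℝ, Continuous g → IntegrableOn (fun y => g y * w y) K := fun g hg =>
    hwK.continuousOn_mul hg.continuousOn hKc
  have hcΔ : Continuous fun y => c ^ finrank ℝ E / (2 * c ^ 3) *
      (Δ fun y => bumpPrimitive (c ^ 2 * ‖x - y‖ ^ 2)) y :=
    ((continuousOn_deriv_pow_mul_bumpProfile x).comp_continuous (f := fun y => (c, y))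
      (by fun_prop) fun y => hc0.ne')
  have key := hasDerivAt_integral_of_dominated_loc_of_deriv_le (𝕜 := ℝ)
    (μ := volume.restrict K) (x₀ := c) (s := Icc a (c + 1)) (bound := fun y => C * ‖w y‖)
    (F := fun c y => c ^ finrank ℝ E * bumpProfile (c ^ 2 * ‖x - y‖ ^ 2) * w y)
    (F' := fun c y => c ^ finrank ℝ E / (2 * c ^ 3) *
        (Δ fun y => bumpPrimitive (c ^ 2 * ‖x - y‖ ^ 2)) y * w y)
    (Icc_mem_nhds hac (by linarith)) (Eventually.of_forall fun c => hmeas _ (by fun_prop))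
    (hwI _ (by fun_prop)) (hmeas _ hcΔ) ?_ (hwK.norm.const_mul C) ?_
  · have h0 : ∫ y in K, c ^ finrank ℝ E / (2 * c ^ 3) *
        (Δ fun y => bumpPrimitive (c ^ 2 * ‖x - y‖ ^ 2)) y * w y = 0 := by
      set ψ : E → ℝ := fun y => bumpPrimitive (c ^ 2 * ‖x - y‖ ^ 2) with hψ
      have hψd : ContDiff ℝ ∞ ψ := by
        have h1 : ContDiff ℝ ∞ fun y : E => ‖x - y‖ ^ 2 :=
          (contDiff_const.sub contDiff_id).norm_sq ℝ
        exact contDiff_bumpPrimitive.comp (contDiff_const.mul h1)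
      have hts : tsupport ψ ⊆ K := by
        refine closure_minimal (fun y hy => ?_) isClosed_closedBall
        by_contra h
        exact hy (bumpPrimitive_eq_zero (one_le_of_notMem_closedBall ha0 hac.le h))
      have h1 := hw.2 ψ hψd (hKc.of_isClosed_subset (isClosed_tsupport _) hts) (hts.trans hKb)
      rw [setIntegral_eq_of_subset_of_forall_sdiff_eq_zero measurableSet_ball hKb] at h1
      · calc ∫ y in K, c ^ finrank ℝ E / (2 * c ^ 3) * (Δ ψ) y * w y
            = ∫ y in K, c ^ finrank ℝ E / (2 * c ^ 3) * (w y * (Δ ψ) y) := by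
              congr 1
              ext1 y
              ring
          _ = 0 := by rw [integral_const_mul, h1, mul_zero]
      · intro y hy
        rw [image_eq_zero_of_notMem_tsupport (f := Δ ψ) fun h =>
          hy.2 (hts (tsupport_laplacian_subset ψ h)), mul_zero]
    rw [h0] at key
    refine key.2.congr_of_eventuallyEq ?_
    filter_upwards [Ioi_mem_nhds hac] with c' hc'
    exact bumpAverage_eq_setIntegral hKb fun y hy =>
      one_le_of_notMem_closedBall ha0 (le_of_lt hc') hy
  · filter_upwards [ae_restrict_mem measurableSet_closedBall] with y hy c' hc'
    rw [norm_mul]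
    gcongr
    exact hC (c', y) ⟨hc', hy⟩
  · filter_upwards with y c' hc'
    exact (hasDerivAt_pow_mul_bumpProfile (ha0.trans_le hc'.1).ne' x y).mul_const (w y)

/-- The total mass of the weight `bumpProfile (|y|²)`. -/
def bumpMass (E : Type*) [NormedAddCommGroup E] [InnerProductSpace ℝ E] [FiniteDimensional ℝ E]
    [MeasurableSpace E] [BorelSpace E] : ℝ := ∫ y : E, bumpProfile (‖y‖ ^ 2)

omit [InnerProductSpace ℝ E] [FiniteDimensional ℝ E] [MeasurableSpace E] [BorelSpace E] in
theorem continuous_bumpProfile_norm_sq : Continuous fun y : E => bumpProfile (‖y‖ ^ 2) := by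
  have := contDiff_bumpProfile.continuous
  fun_prop

omit [InnerProductSpace ℝ E] [FiniteDimensional ℝ E] [MeasurableSpace E] [BorelSpace E] in
theorem bumpProfile_norm_sq_eq_zero {y : E} (hy : y ∉ ball (0 : E) 1) :
    bumpProfile (‖y‖ ^ 2) = 0 := by
  rw [mem_ball_zero_iff, not_lt] at hy
  exact bumpProfile_eq_zero (one_le_pow₀ hy)

omit [MeasurableSpace E] [BorelSpace E] in
theorem hasCompactSupport_bumpProfile_norm_sq :
    HasCompactSupport fun y : E => bumpProfile (‖y‖ ^ 2) :=
  HasCompactSupport.intro (isCompact_closedBall (0 : E) 1) fun _ hy =>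
    bumpProfile_norm_sq_eq_zero fun h => hy (ball_subset_closedBall h)

theorem bumpMass_pos : 0 < bumpMass E := by
  refine continuous_bumpProfile_norm_sq.integral_pos_of_hasCompactSupport_nonneg_nonzero
    hasCompactSupport_bumpProfile_norm_sq (fun y => bumpProfile_nonneg _) (x := 0) ?_
  exact (bumpProfile_pos (by simp)).ne'

/-- The averages do not depend on the radius and converge to the value of the function as the
radius tends to zero. -/
theorem IsWeaklyHarmonic.bumpAverage_eq {w : E → ℝ} (hw : IsWeaklyHarmonic w) {x : E} {c : ℝ}
    (hx : ‖x‖ < 1) (hwx : ContinuousAt w x) (hc : 1 < c * (1 - ‖x‖)) :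
    bumpAverage w x c = bumpMass E * w x := by
  have hx' : 0 < 1 - ‖x‖ := by linarith
  have hc1 : 1 / (1 - ‖x‖) < c := by rwa [div_lt_iff₀ hx']
  have hc0 : 0 < c := lt_trans (by positivity) hc1
  have hconst : ∀ c' ∈ Ioi (1 / (1 - ‖x‖)), bumpAverage w x c' = bumpAverage w x c := by
    have hd : ∀ c' ∈ Ioi (1 / (1 - ‖x‖)), HasDerivAt (bumpAverage w x) 0 c' := fun c' hc' =>
      hw.hasDerivAt_bumpAverage hx (by rwa [mem_Ioi, div_lt_iff₀ hx'] at hc')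
    intro c' hc'
    exact isOpen_Ioi.is_const_of_deriv_eq_zero isPreconnected_Ioi
      (fun t ht => (hd t ht).differentiableAt.differentiableWithinAt)
      (fun t ht => (hd t ht).deriv) hc' hc1
  set K := closedBall x (1 / c) with hK
  have hKb : K ⊆ ball 0 1 := closedBall_subset_ball_zero_one hc0 hc
  have hKc : IsCompact K := isCompact_closedBall _ _
  have hwK : IntegrableOn w K := (hw.1.mono_set hKb).integrableOn_isCompact hKc
  have hm := bumpMass_pos (E := E)
  have hgx : ContinuousAt (K.indicator w) x := by
    refine hwx.congr ?_
    filter_upwards [closedBall_mem_nhds x (show 0 < 1 / c by positivity)] with y hy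
    rw [indicator_of_mem hy]
  have hlim := tendsto_integral_comp_smul_smul_of_integrable' (μ := (volume : Measure E))
    (φ := fun y : E => (bumpMass E)⁻¹ * bumpProfile (‖y‖ ^ 2))
    (fun y => mul_nonneg (by positivity) (bumpProfile_nonneg _)) ?_ ?_
    (hwK.integrable_indicator measurableSet_closedBall) hgx
  · have hlim2 : Tendsto (fun _ : ℝ => (bumpMass E)⁻¹ * bumpAverage w x c) atTop (𝓝 (w x)) := by
      have hxK : K.indicator w x = w x :=
        indicator_of_mem (mem_closedBall_self (by positivity)) w
      rw [hxK] at hlim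
      refine hlim.congr' ?_
      filter_upwards [eventually_ge_atTop c] with c' hc'
      rw [← hconst c' (lt_of_lt_of_le hc1 hc'), bumpAverage_eq_setIntegral
        hKb fun y hy => one_le_of_notMem_closedBall hc0 hc' hy,
        ← integral_const_mul, ← integral_indicator measurableSet_closedBall]
      congr 1
      ext1 y
      by_cases hy : y ∈ K
      · rw [indicator_of_mem hy, indicator_of_mem hy, norm_smul, mul_pow, Real.norm_eq_abs, sq_abs,
          smul_eq_mul]
        ring
      · rw [indicator_of_notMem hy, indicator_of_notMem hy, smul_zero]
    have h := tendsto_nhds_unique hlim2 tendsto_const_nhds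
    rw [h]
    field_simp
  · rw [integral_const_mul]
    exact inv_mul_cancel₀ hm.ne'
  · refine tendsto_const_nhds.congr' ?_
    filter_upwards [Bornology.isBounded_def.1 (isBounded_ball (x := (0 : E)) (r := 1))] with y hy
    rw [bumpProfile_norm_sq_eq_zero hy, mul_zero, mul_zero]

/-- The mean value property on the unit ball for averages with the radial weight
`bumpProfile (|y|²)`. -/
def HasMeanValue (v : E → ℝ) : Prop :=
  ∀ x : E, ‖x‖ < 1 → ∀ r : ℝ, 0 < r → r < 1 - ‖x‖ →
    ∫ y : E, bumpProfile (‖y‖ ^ 2) * v (x + r • y) = bumpMass E * v x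

omit [InnerProductSpace ℝ E] [FiniteDimensional ℝ E] [MeasurableSpace E] [BorelSpace E] in
theorem add_smul_mem_ball [NormedSpace ℝ E] {x y : E} {r : ℝ} (hr : 0 < r) (hrx : r < 1 - ‖x‖)
    (hy : ‖y‖ ≤ 1) :
    x + r • y ∈ ball (0 : E) 1 := by
  rw [mem_ball_zero_iff]
  calc ‖x + r • y‖ ≤ ‖x‖ + ‖r • y‖ := norm_add_le _ _
    _ = ‖x‖ + r * ‖y‖ := by rw [norm_smul, Real.norm_of_nonneg hr.le]
    _ ≤ ‖x‖ + r * 1 := by gcongr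
    _ < 1 := by linarith

theorem IsWeaklyHarmonic.hasMeanValue {v : E → ℝ} (hv : IsWeaklyHarmonic v)
    (hc : ContinuousOn v (ball 0 1)) : HasMeanValue v := by
  intro x hx r hr hrx
  have hxb : x ∈ ball (0 : E) 1 := by simpa using hx
  have h1 := hv.bumpAverage_eq (c := r⁻¹) hx (hc.continuousAt (isOpen_ball.mem_nhds hxb)) (by
    rw [inv_mul_eq_div, one_lt_div hr]
    exact hrx)
  have h0 := integral_add_left_eq_self (μ := (volume : Measure E))
    (fun y => (ball (0 : E) 1).indicator (fun y => r⁻¹ ^ finrank ℝ E *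
      bumpProfile (r⁻¹ ^ 2 * ‖x - y‖ ^ 2) * v y) y) x
  rw [← h1, bumpAverage, ← integral_indicator measurableSet_ball, ← h0]
  set f : E → ℝ := fun y => (ball (0 : E) 1).indicator (fun y => r⁻¹ ^ finrank ℝ E *
    bumpProfile (r⁻¹ ^ 2 * ‖x - y‖ ^ 2) * v y) (x + y) with hf
  have h2 := Measure.integral_comp_smul volume f r
  have h3 : ∀ y, f (r • y) = r⁻¹ ^ finrank ℝ E * (bumpProfile (‖y‖ ^ 2) * v (x + r • y)) := by
    intro y
    have hn : r⁻¹ ^ 2 * ‖x - (x + r • y)‖ ^ 2 = ‖y‖ ^ 2 := by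
      rw [sub_add_cancel_left, norm_neg, norm_smul, Real.norm_of_nonneg hr.le]
      field_simp
    by_cases hy : x + r • y ∈ ball (0 : E) 1
    · rw [hf]
      simp only
      rw [indicator_of_mem hy, hn]
      ring
    · rw [hf]
      simp only
      rw [indicator_of_notMem hy, bumpProfile_norm_sq_eq_zero, zero_mul, mul_zero]
      intro hy1
      refine hy ?_
      exact add_smul_mem_ball hr hrx (mem_ball_zero_iff.1 hy1).le
  simp only [h3] at h2
  rw [integral_const_mul, abs_of_pos (by positivity), smul_eq_mul, inv_pow] at h2
  exact mul_left_cancel₀ (inv_ne_zero (pow_ne_zero _ hr.ne')) h2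

end MeanValue

/-! ### Maximum principle and uniqueness -/

section Uniqueness

open Module (finrank)

variable {E : Type*} [NormedAddCommGroup E] [InnerProductSpace ℝ E] [FiniteDimensional ℝ E]
  [MeasurableSpace E] [BorelSpace E]

theorem integrable_bumpProfile_mul {v : E → ℝ} (hv : ContinuousOn v (closedBall 0 1)) {x : E}
    {r : ℝ} (hr : 0 < r) (hrx : r < 1 - ‖x‖) :
    Integrable fun y : E => bumpProfile (‖y‖ ^ 2) * v (x + r • y) := by
  refine (integrableOn_iff_integrable_of_support_subset (s := closedBall (0 : E) 1)
    fun y hy => ?_).1 ?_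
  · by_contra h
    refine left_ne_zero_of_mul hy (bumpProfile_norm_sq_eq_zero fun h' => h ?_)
    exact ball_subset_closedBall h'
  · refine ContinuousOn.integrableOn_compact (isCompact_closedBall _ _) ?_
    refine continuous_bumpProfile_norm_sq.continuousOn.mul (hv.comp (by fun_prop) fun y hy => ?_)
    exact ball_subset_closedBall (add_smul_mem_ball hr hrx (by simpa using hy))

/-- If the maximum is attained in the open ball, it is also attained on a sphere about that point
that touches the unit sphere. -/
theorem HasMeanValue.le_of_le_on_sphere [Nontrivial E] {v : E → ℝ} (hv : HasMeanValue v)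
    (hc : ContinuousOn v (closedBall 0 1)) {M : ℝ} (hM : ∀ x : E, ‖x‖ = 1 → v x ≤ M) {x : E}
    (hx : x ∈ closedBall (0 : E) 1) : v x ≤ M := by
  obtain ⟨p, hp, hpmax⟩ := (isCompact_closedBall (0 : E) 1).exists_isMaxOn ⟨0, by simp⟩ hc
  refine (hpmax hx).trans ?_
  rw [mem_closedBall_zero_iff] at hp
  rcases hp.eq_or_lt with hp1 | hp1
  · exact hM p hp1
  set R := 1 - ‖p‖ with hR
  have hR0 : 0 < R := by linarith
  have hle : ∀ y ∈ closedBall (0 : E) 1, v y ≤ v p := fun y hy => hpmax hy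
  have hball : ∀ e : E, ‖e‖ = 1 → ∀ τ ∈ Ico 0 R, v (p + τ • e) = v p := by
    intro e he τ hτ
    obtain ⟨r, hr1, hr2⟩ := exists_between hτ.2
    have hr0 : 0 < r := hτ.1.trans_lt hr1
    set y₀ : E := (τ / r) • e with hy₀
    have hy₀n : ‖y₀‖ < 1 := by
      rw [hy₀, norm_smul, he, mul_one, Real.norm_of_nonneg (by have := hτ.1; positivity),
        div_lt_one hr0]
      exact hr1
    have hpy : p + r • y₀ = p + τ • e := by
      rw [hy₀, smul_smul, mul_div_cancel₀ _ hr0.ne']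
    have hmv := hv p hp1 r hr0 hr2
    have hi1 := integrable_bumpProfile_mul hc hr0 hr2
    have hi2 : Integrable fun y : E => bumpProfile (‖y‖ ^ 2) * v p :=
      (continuous_bumpProfile_norm_sq.integrable_of_hasCompactSupport
        hasCompactSupport_bumpProfile_norm_sq).mul_const _
    have hi12 : Integrable fun y : E =>
        bumpProfile (‖y‖ ^ 2) * v p - bumpProfile (‖y‖ ^ 2) * v (p + r • y) := hi2.sub hi1
    have hzero : ∫ y : E,
        (bumpProfile (‖y‖ ^ 2) * v p - bumpProfile (‖y‖ ^ 2) * v (p + r • y)) = 0 := by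
      rw [integral_sub hi2 hi1, hmv, integral_mul_const, bumpMass, sub_self]
    have hnn : ∀ y : E,
        0 ≤ bumpProfile (‖y‖ ^ 2) * v p - bumpProfile (‖y‖ ^ 2) * v (p + r • y) := by
      intro y
      by_cases hy : y ∈ ball (0 : E) 1
      · rw [← mul_sub]
        refine mul_nonneg (bumpProfile_nonneg _) (sub_nonneg.2 (hle _ ?_))
        exact ball_subset_closedBall (add_smul_mem_ball hr0 hr2 (mem_ball_zero_iff.1 hy).le)
      · rw [bumpProfile_norm_sq_eq_zero hy]
        simp
    have hae := (integral_eq_zero_iff_of_nonneg hnn hi12).1 hzero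
    have hcon : ContinuousOn (fun y : E =>
        bumpProfile (‖y‖ ^ 2) * v p - bumpProfile (‖y‖ ^ 2) * v (p + r • y)) (ball 0 1) := by
      have h1 : ContinuousOn (fun y : E => v (p + r • y)) (ball 0 1) :=
        hc.comp (by fun_prop) fun y hy =>
          ball_subset_closedBall (add_smul_mem_ball hr0 hr2 (mem_ball_zero_iff.1 hy).le)
      have h2 := (continuous_bumpProfile_norm_sq (E := E)).continuousOn (s := ball 0 1)
      exact (h2.mul continuousOn_const).sub (h2.mul h1)
    have heq := Measure.eqOn_open_of_ae_eq (ae_restrict_of_ae hae) isOpen_ball hcon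
      continuousOn_const (mem_ball_zero_iff.2 hy₀n)
    simp only [Pi.zero_apply, ← mul_sub, mul_eq_zero] at heq
    rw [hpy] at heq
    rcases heq with h | h
    · exact absurd h (bumpProfile_pos (pow_lt_one₀ (norm_nonneg _) hy₀n two_ne_zero)).ne'
    · linarith
  -- a unit vector pointing from `p` to the closest point of the unit sphere
  obtain ⟨e, he, hpe⟩ : ∃ e : E, ‖e‖ = 1 ∧ p = ‖p‖ • e := by
    rcases eq_or_ne p 0 with rfl | hp0
    · obtain ⟨e, he⟩ := exists_norm_eq E (zero_le_one (α := ℝ))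
      exact ⟨e, he, by simp⟩
    · refine ⟨‖p‖⁻¹ • p, by simp [norm_smul, hp0], ?_⟩
      rw [smul_smul, mul_inv_cancel₀ (norm_ne_zero_iff.2 hp0), one_smul]
  have hend : p + R • e = e := by
    conv_lhs => rw [hpe]
    rw [← add_smul, hR]
    simp
  have hcl : ContinuousWithinAt (fun τ : ℝ => v (p + τ • e)) (Ico 0 R) R := by
    refine ContinuousWithinAt.comp (t := closedBall 0 1) ?_ (by fun_prop) fun τ hτ => ?_
    · rw [hend]
      exact hc e (by simp [he])
    · rw [mem_closedBall_zero_iff]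
      calc ‖p + τ • e‖ ≤ ‖p‖ + ‖τ • e‖ := norm_add_le _ _
        _ = ‖p‖ + τ := by rw [norm_smul, he, mul_one, Real.norm_of_nonneg hτ.1]
        _ ≤ 1 := by linarith [hτ.2]
  have hne : (𝓝[Ico 0 R] R).NeBot := by
    rw [← mem_closure_iff_nhdsWithin_neBot, closure_Ico hR0.ne]
    exact right_mem_Icc.2 hR0.le
  have hlim : Tendsto (fun τ : ℝ => v (p + τ • e)) (𝓝[Ico 0 R] R) (𝓝 (v p)) :=
    tendsto_const_nhds.congr' (by
      filter_upwards [self_mem_nhdsWithin] with τ hτ using (hball e he τ hτ).symm)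
  have h := tendsto_nhds_unique hlim hcl.tendsto
  rw [h, hend]
  exact hM e he

theorem HasMeanValue.sub_comp_smul {v : E → ℝ} (hv : HasMeanValue v)
    (hc : ContinuousOn v (closedBall 0 1)) {t : ℝ} (ht0 : 0 < t) (ht1 : t < 1) :
    HasMeanValue fun x => v x - v (t • x) := by
  intro x hx r hr hrx
  have htx : ‖t • x‖ < 1 := by
    rw [norm_smul, Real.norm_of_nonneg ht0.le]
    nlinarith [norm_nonneg x]
  have htr : t * r < 1 - ‖t • x‖ := by
    rw [norm_smul, Real.norm_of_nonneg ht0.le]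
    nlinarith
  have h1 := hv x hx r hr hrx
  have h2 := hv (t • x) htx (t * r) (by positivity) htr
  have i1 := integrable_bumpProfile_mul hc hr hrx
  have i2 := integrable_bumpProfile_mul hc (by positivity) htr
  simp only [smul_add, smul_smul, mul_sub]
  rw [integral_sub i1 i2, h1, h2]

theorem HasMeanValue.neg {v : E → ℝ} (hv : HasMeanValue v) : HasMeanValue fun x => -v x := by
  intro x hx r hr hrx
  simp only [mul_neg, integral_neg, hv x hx r hr hrx]

/-- If the radial derivative vanishes, uniformly, on the unit sphere, then the maximum principle
for the differences `v x - v (t x)` shows that it vanishes in the whole ball. -/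
theorem HasMeanValue.eq_apply_zero [Nontrivial E] {v : E → ℝ} (hv : HasMeanValue v)
    (hc : ContinuousOn v (closedBall 0 1))
    (hrad : ∀ ε > 0, ∃ δ < 1, ∀ x : E, ‖x‖ = 1 → ∀ t ∈ Ioo δ 1, |v x - v (t • x)| ≤ ε * (1 - t))
    {x : E} (hx : x ∈ closedBall (0 : E) 1) : v x = v 0 := by
  have hall : ∀ ε > 0, ∃ δ < 1, 0 ≤ δ ∧ ∀ x ∈ closedBall (0 : E) 1, ∀ t ∈ Ioo δ 1,
      |v x - v (t • x)| ≤ ε * (1 - t) := by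
    intro ε hε
    obtain ⟨δ, hδ, h⟩ := hrad ε hε
    refine ⟨max δ 0, max_lt hδ one_pos, le_max_right _ _, fun x hx t ht => ?_⟩
    have ht0 : 0 < t := (le_max_right _ _).trans_lt ht.1
    have htδ : δ < t := (le_max_left _ _).trans_lt ht.1
    have hcd : ContinuousOn (fun x => v x - v (t • x)) (closedBall 0 1) := by
      refine hc.sub (hc.comp (by fun_prop) fun x hx => ?_)
      rw [mem_closedBall_zero_iff] at hx ⊢
      rw [norm_smul, Real.norm_of_nonneg ht0.le]
      nlinarith [ht.2, norm_nonneg x]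
    have hd := hv.sub_comp_smul hc ht0 ht.2
    refine abs_le.2 ⟨?_, ?_⟩
    · have := hd.neg.le_of_le_on_sphere hcd.neg (M := ε * (1 - t))
        (fun y hy => by linarith [(abs_le.1 (h y hy t ⟨htδ, ht.2⟩)).1]) hx
      linarith
    · exact hd.le_of_le_on_sphere hcd
        (fun y hy => (abs_le.1 (h y hy t ⟨htδ, ht.2⟩)).2) hx
  rw [mem_closedBall_zero_iff] at hx
  have hmem : ∀ s ∈ Icc (0 : ℝ) 1, s • x ∈ closedBall (0 : E) 1 := by
    intro s hs
    rw [mem_closedBall_zero_iff, norm_smul, Real.norm_of_nonneg hs.1]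
    nlinarith [hs.1, hs.2, norm_nonneg x]
  have hcf : ContinuousOn (fun s : ℝ => v (s • x)) (Icc 0 1) := hc.comp (by fun_prop) hmem
  -- compare `v (s' x)` with `v (s x) = v ((s / s') s' x)` for `s' > s` close to `s`
  have hder : ∀ s ∈ Ioo (0 : ℝ) 1, HasDerivWithinAt (fun s : ℝ => v (s • x)) 0 (Ici s) s := by
    intro s hs
    rw [hasDerivWithinAt_iff_isLittleO, Asymptotics.isLittleO_iff]
    intro C hC
    obtain ⟨δ, hδ1, hδ0, h⟩ := hall (C * s) (mul_pos hC hs.1)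
    -- the bound on `s'` ensures `δ < s / s'`; the value `1 / 2` only keeps the divisor positive
    have hlt : s < min 1 (s / max δ (1 / 2)) := by
      refine lt_min hs.2 ?_
      rw [lt_div_iff₀ (by positivity)]
      have : max δ (1 / 2) < 1 := max_lt hδ1 (by norm_num)
      nlinarith [hs.1]
    filter_upwards [self_mem_nhdsWithin, mem_nhdsWithin_of_mem_nhds (Iio_mem_nhds hlt)]
      with s' hs' hs'2
    rcases (show s ≤ s' from hs').eq_or_lt with rfl | hss
    · simp
    have hs'0 : 0 < s' := hs.1.trans hss
    have hs'1 : s' < 1 := lt_of_lt_of_le hs'2 (min_le_left _ _)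
    have hδs : s' < s / max δ (1 / 2) := lt_of_lt_of_le hs'2 (min_le_right _ _)
    rw [lt_div_iff₀ (by positivity)] at hδs
    have hratio : s / s' ∈ Ioo δ 1 := by
      refine ⟨?_, (div_lt_one hs'0).2 hss⟩
      rw [lt_div_iff₀ hs'0]
      nlinarith [le_max_left δ (1 / 2)]
    have h1 := h (s' • x) (hmem s' ⟨hs'0.le, hs'1.le⟩) (s / s') hratio
    rw [smul_smul, div_mul_cancel₀ _ hs'0.ne'] at h1
    simp only [smul_zero, sub_zero, Real.norm_eq_abs]
    rw [abs_of_pos (sub_pos.2 hss)]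
    refine h1.trans ?_
    have h2 : C * s * (1 - s / s') = C * (s' - s) * (s / s') := by
      field_simp
    rw [h2]
    have h3 : 0 ≤ C * (s' - s) := mul_nonneg hC.le (by linarith)
    nlinarith [hratio.2]
  have hconst : ∀ a ∈ Ioo (0 : ℝ) 1, v (a • x) = v x := by
    intro a ha
    have := constant_of_has_deriv_right_zero (hcf.mono (Icc_subset_Icc_left ha.1.le))
      (fun s hs => hder s ⟨ha.1.trans_le hs.1, hs.2⟩) 1 (right_mem_Icc.2 ha.2.le)
    rw [one_smul] at this
    exact this.symm
  have hlim : Tendsto (fun s : ℝ => v (s • x)) (𝓝[Ioo 0 1] 0) (𝓝 (v 0)) := by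
    have := (hcf 0 (by simp)).tendsto.mono_left (nhdsWithin_mono _ Ioo_subset_Icc_self)
    rwa [zero_smul] at this
  have hlim2 : Tendsto (fun s : ℝ => v (s • x)) (𝓝[Ioo 0 1] 0) (𝓝 (v x)) :=
    tendsto_const_nhds.congr' (by
      filter_upwards [self_mem_nhdsWithin] with a ha using (hconst a ha).symm)
  have hne : (𝓝[Ioo (0 : ℝ) 1] 0).NeBot := by
    rw [← mem_closure_iff_nhdsWithin_neBot, closure_Ioo zero_ne_one]
    simp
  exact tendsto_nhds_unique hlim2 hlim

/-- An isolated singularity of a weakly harmonic function that is continuous elsewhere is removable,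
because averages at a fixed scale are continuous up to that point. -/
theorem IsWeaklyHarmonic.exists_tendsto {w : E → ℝ} (hw : IsWeaklyHarmonic w) {z : E}
    (hz : ‖z‖ < 1) (hc : ContinuousOn w (ball 0 1 \ {z})) :
    ∃ l, Tendsto w (𝓝[≠] z) (𝓝 l) := by
  -- for `|x - z| < r` the ball of radius `r` about `x` stays in a fixed compact ball about `z`
  set r := (1 - ‖z‖) / 4 with hr
  have hr0 : 0 < r := by
    rw [hr]
    linarith
  set K := closedBall z (2 * r) with hK
  have hKb : K ⊆ ball 0 1 := by
    refine closedBall_subset_ball' ?_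
    rw [dist_zero_right]
    linarith
  have hKc : IsCompact K := isCompact_closedBall _ _
  have hwK : IntegrableOn w K := (hw.1.mono_set hKb).integrableOn_isCompact hKc
  have hbc := contDiff_bumpProfile.continuous
  set J : E → ℝ := fun x => ∫ y in K, r⁻¹ ^ finrank ℝ E *
    bumpProfile (r⁻¹ ^ 2 * ‖x - y‖ ^ 2) * w y with hJ
  have hJc : ContinuousAt J z := by
    obtain ⟨C, hC⟩ := ((isCompact_closedBall z r).prod hKc).exists_bound_of_continuousOn
      (f := fun p : E × E => r⁻¹ ^ finrank ℝ E * bumpProfile (r⁻¹ ^ 2 * ‖p.1 - p.2‖ ^ 2))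
      (by fun_prop)
    refine continuousAt_of_dominated (bound := fun y => C * ‖w y‖) ?_ ?_ (hwK.norm.const_mul C) ?_
    · refine Eventually.of_forall fun x => ?_
      have : Continuous fun y => r⁻¹ ^ finrank ℝ E * bumpProfile (r⁻¹ ^ 2 * ‖x - y‖ ^ 2) := by
        fun_prop
      exact this.aestronglyMeasurable.mul hwK.aestronglyMeasurable
    · filter_upwards [closedBall_mem_nhds z hr0] with x hx
      filter_upwards [ae_restrict_mem measurableSet_closedBall] with y hy
      rw [norm_mul]
      gcongr
      exact hC (x, y) ⟨hx, hy⟩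
    · refine Eventually.of_forall fun y => ?_
      fun_prop
  refine ⟨(bumpMass E)⁻¹ * J z, ?_⟩
  refine Tendsto.congr' ?_ ((hJc.tendsto.const_mul _).mono_left nhdsWithin_le_nhds)
  filter_upwards [self_mem_nhdsWithin,
    mem_nhdsWithin_of_mem_nhds (ball_mem_nhds z hr0)] with x hxz hx
  rw [mem_ball, dist_eq_norm] at hx
  have hxn : ‖x‖ < ‖z‖ + r := by
    have := norm_sub_norm_le x z
    linarith
  have hx1 : ‖x‖ < 1 := by linarith
  have hcx : ContinuousAt w x := hc.continuousAt
    ((isOpen_ball.sdiff isClosed_singleton).mem_nhds ⟨by simpa using hx1, hxz⟩)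
  have h1 := hw.bumpAverage_eq (c := r⁻¹) hx1 hcx (by
    rw [inv_mul_eq_div, one_lt_div hr0]
    linarith)
  have h2 : bumpAverage w x r⁻¹ = J x := by
    refine bumpAverage_eq_setIntegral hKb fun y hy => ?_
    refine one_le_of_notMem_closedBall (c := r⁻¹) (by positivity) le_rfl fun hy' => hy ?_
    rw [one_div, inv_inv, mem_closedBall, dist_eq_norm] at hy'
    rw [mem_closedBall, dist_eq_norm]
    calc ‖y - z‖ = ‖(y - x) + (x - z)‖ := by abel_nf
      _ ≤ ‖y - x‖ + ‖x - z‖ := norm_add_le _ _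
      _ ≤ 2 * r := by linarith
  rw [← h2, h1, inv_mul_cancel_left₀ bumpMass_pos.ne']

omit [MeasurableSpace E] [BorelSpace E] in
/-- The Neumann condition for a function that is `C¹` up to the sphere, as a uniform estimate. -/
theorem radial_difference_le {w : E → ℝ} {z : E} (hz : ‖z‖ < 1)
    (hC1 : ContDiffOn ℝ 1 w (closedBall 0 1 \ {z}))
    (hN : ∀ x ∈ sphere (0 : E) 1, fderivWithin ℝ w (closedBall 0 1) x x = 0) {ε : ℝ}
    (hε : 0 < ε) :
    ∃ δ < 1, ‖z‖ ≤ δ ∧ ∀ x : E, ‖x‖ = 1 → ∀ t ∈ Ioo δ 1, |w x - w (t • x)| ≤ ε * (1 - t) := by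
  set S := closedBall (0 : E) 1 \ {z} with hS
  have hudc : UniqueDiffOn ℝ (closedBall (0 : E) 1) := uniqueDiffOn_convex (convex_closedBall _ _)
    ⟨0, ball_subset_interior_closedBall (mem_ball_self one_pos)⟩
  have hud : UniqueDiffOn ℝ S := hudc.inter isOpen_compl_singleton
  have hfc := hC1.continuousOn_fderivWithin hud le_rfl
  -- the closed annulus `ρ ≤ |x| ≤ 1` is compact and avoids `z`
  obtain ⟨ρ, hρz, hρ1⟩ := exists_between hz
  have hρ0 : 0 < ρ := (norm_nonneg z).trans_lt hρz
  have hmemS : ∀ s ∈ Icc ρ 1, ∀ x : E, ‖x‖ = 1 → s • x ∈ S := by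
    intro s hs x hx
    have hs0 : 0 < s := hρ0.trans_le hs.1
    have hn : ‖s • x‖ = s := by rw [norm_smul, hx, mul_one, Real.norm_of_nonneg hs0.le]
    refine ⟨by rw [mem_closedBall_zero_iff, hn]; exact hs.2, fun h => ?_⟩
    rw [mem_singleton_iff] at h
    rw [h] at hn
    linarith [hs.1]
  set H : ℝ × E → ℝ := fun p => fderivWithin ℝ w S (p.1 • p.2) p.2 with hH
  have hHc : ContinuousOn H (Icc ρ 1 ×ˢ sphere (0 : E) 1) := by
    refine ContinuousOn.clm_apply (hfc.comp (by fun_prop) fun p hp => ?_) continuousOn_snd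
    exact hmemS p.1 hp.1 p.2 (by simpa using hp.2)
  have hH1 : ∀ x : E, ‖x‖ = 1 → H (1, x) = 0 := by
    intro x hx
    have hxz : x ≠ z := by
      rintro rfl
      linarith
    rw [hH]
    simp only [one_smul]
    rw [hS, sdiff_eq, fderivWithin_inter (isOpen_compl_singleton.mem_nhds hxz)]
    exact hN x (by simpa using hx)
  have huc := ((isCompact_Icc (a := ρ) (b := 1)).prod
    (isCompact_sphere (0 : E) 1)).uniformContinuousOn_of_continuous hHc
  obtain ⟨η, hη, hdist⟩ := Metric.uniformContinuousOn_iff.1 huc ε hε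
  refine ⟨max ρ (1 - η), max_lt hρ1 (by linarith), hρz.le.trans (le_max_left _ _),
    fun x hx t ht => ?_⟩
  have htρ : ρ < t := (le_max_left _ _).trans_lt ht.1
  have htη : 1 - η < t := (le_max_right _ _).trans_lt ht.1
  have hxs : x ∈ sphere (0 : E) 1 := by simpa using hx
  have hbound : ∀ s ∈ Ico t 1, ‖H (s, x)‖ ≤ ε := by
    intro s hs
    have h1 := hdist (s, x) ⟨⟨htρ.le.trans hs.1, hs.2.le⟩, hxs⟩ (1, x)
      ⟨right_mem_Icc.2 hρ1.le, hxs⟩ (by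
        rw [Prod.dist_eq, dist_self, Real.dist_eq, abs_of_nonpos (by linarith [hs.2])]
        exact max_lt (by linarith [hs.1]) hη)
    rw [hH1 x hx, dist_zero_right] at h1
    exact h1.le
  have hder : ∀ s ∈ Icc t 1, HasDerivWithinAt (fun s : ℝ => w (s • x)) (H (s, x)) (Icc t 1) s := by
    intro s hs
    have h1 : HasDerivWithinAt (fun s : ℝ => s • x) x (Icc t 1) s := by
      simpa using ((hasDerivAt_id s).smul_const x).hasDerivWithinAt
    have h2 : HasFDerivWithinAt w (fderivWithin ℝ w S (s • x)) S (s • x) :=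
      ((hC1.differentiableOn (by simp)) _
        (hmemS s ⟨htρ.le.trans hs.1, hs.2⟩ x hx)).hasFDerivWithinAt
    exact h2.comp_hasDerivWithinAt s h1 fun s' hs' =>
      hmemS s' ⟨htρ.le.trans hs'.1, hs'.2⟩ x hx
  have := norm_image_sub_le_of_norm_deriv_le_segment' hder hbound 1 (right_mem_Icc.2 ht.2.le)
  rwa [one_smul, Real.norm_eq_abs] at this

/-- Uniqueness up to a constant for the Neumann problem, for functions that may be undefined at one
point. -/
theorem IsWeaklyHarmonic.exists_eq_const [Nontrivial E] {w : E → ℝ} (hw : IsWeaklyHarmonic w)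
    {z : E} (hz : ‖z‖ < 1) (hC1 : ContDiffOn ℝ 1 w (closedBall 0 1 \ {z}))
    (hN : ∀ x ∈ sphere (0 : E) 1, fderivWithin ℝ w (closedBall 0 1) x x = 0) :
    ∃ C : ℝ, ∀ x ∈ closedBall (0 : E) 1 \ {z}, w x = C := by
  classical
  obtain ⟨l, hl⟩ := hw.exists_tendsto hz
    (hC1.continuousOn.mono (sdiff_subset_sdiff_left ball_subset_closedBall))
  set v := Function.update w z l with hv
  have hvw : ∀ x, x ≠ z → v x = w x := fun x hx => Function.update_of_ne hx _ _
  have hvc : ContinuousOn v (closedBall 0 1) := by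
    intro x hx
    rcases eq_or_ne x z with rfl | hxz
    · exact (continuousAt_update_same.2 hl).continuousWithinAt
    · have h1 : ContinuousWithinAt w (closedBall 0 1) x := by
        refine (hC1.continuousOn x ⟨hx, hxz⟩).mono_of_mem_nhdsWithin ?_
        exact inter_mem self_mem_nhdsWithin
          (mem_nhdsWithin_of_mem_nhds (isOpen_compl_singleton.mem_nhds hxz))
      exact (continuousWithinAt_update_of_ne hxz).2 h1
  have hae : w =ᵐ[volume] v := by
    filter_upwards [Measure.ae_ne volume z] with x hx using (hvw x hx).symm
  have hmv := (hw.congr_ae hae).hasMeanValue (hvc.mono ball_subset_closedBall)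
  refine ⟨v 0, fun x hx => ?_⟩
  rw [← hvw x hx.2]
  refine hmv.eq_apply_zero hvc (fun ε hε => ?_) hx.1
  obtain ⟨δ, hδ, hzδ, h⟩ := radial_difference_le hz hC1 hN hε
  refine ⟨δ, hδ, fun y hy t ht => ?_⟩
  have ht0 : 0 < t := (norm_nonneg z).trans_lt (hzδ.trans_lt ht.1)
  rw [hvw, hvw]
  · exact h y hy t ht
  · intro h0
    have : ‖t • y‖ = t := by rw [norm_smul, hy, mul_one, Real.norm_of_nonneg ht0.le]
    rw [h0] at this
    linarith [ht.1]
  · rintro rfl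
    linarith

variable {n : ℕ}

theorem IsEEGSolution.exists_eq_eegGreen_add (hn : 1 ≤ n) {D z : EuclideanSpace ℝ (Fin n)}
    (hz : z ∈ ball (0 : EuclideanSpace ℝ (Fin n)) 1) {u : EuclideanSpace ℝ (Fin n) → ℝ}
    (hu : IsEEGSolution n D z u) :
    ∃ C : ℝ, ∀ x ∈ closedBall (0 : EuclideanSpace ℝ (Fin n)) 1 \ {z},
      u x = eegGreen n D z x + C := by
  have := nontrivial_euclideanSpace hn
  have hz1 : ‖z‖ < 1 := by simpa using hz
  have hg : IsEEGSolution n D z (eegGreen n D z) :=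
    isEEGSolution_of_eq_eegGreen_add hn hz (C := 0) fun x _ => by simp
  have hw : IsWeaklyHarmonic (fun x => u x - eegGreen n D z x) := by
    refine ⟨hu.1.1.sub hg.1.1, fun φ hφ hc hs => ?_⟩
    have hi : ∀ f : EuclideanSpace ℝ (Fin n) → ℝ, LocallyIntegrableOn f (ball 0 1) volume →
        IntegrableOn (fun x => f x * (Δ φ) x) (ball 0 1) := by
      intro f hf
      have h1 : IntegrableOn (fun x => f x * (Δ φ) x) (tsupport φ) :=
        ((hf.mono_set hs).integrableOn_isCompact hc.isCompact).mul_continuousOn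
          (continuous_laplacian hφ).continuousOn hc.isCompact
      have hsupp : Function.support (fun x => f x * (Δ φ) x) ⊆ tsupport φ := fun x hx =>
        tsupport_laplacian_subset φ (subset_tsupport _ (right_ne_zero_of_mul hx))
      exact ((integrableOn_iff_integrable_of_support_subset hsupp).1 h1).integrableOn
    simp only [sub_mul]
    rw [integral_sub (hi u hu.1.1) (hi _ hg.1.1), hu.1.2 φ hφ hc hs, hg.1.2 φ hφ hc hs, sub_self]
  obtain ⟨C, hC⟩ := hw.exists_eq_const hz1 (hu.2.1.sub hg.2.1) (by
    intro x hx
    have hxc : x ∈ closedBall (0 : EuclideanSpace ℝ (Fin n)) 1 := sphere_subset_closedBall hx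
    have hxz : x ≠ z := by
      rintro rfl
      rw [mem_sphere_zero_iff_norm] at hx
      linarith
    have hd : ∀ f : EuclideanSpace ℝ (Fin n) → ℝ, ContDiffOn ℝ 1 f (closedBall 0 1 \ {z}) →
        DifferentiableWithinAt ℝ f (closedBall 0 1) x := fun f hf =>
      ((hf.differentiableOn (by simp)) x ⟨hxc, hxz⟩).mono_of_mem_nhdsWithin
        (inter_mem self_mem_nhdsWithin
          (mem_nhdsWithin_of_mem_nhds (isOpen_compl_singleton.mem_nhds hxz)))
    rw [fderivWithin_fun_sub (uniqueDiffOn_closedBall x hxc) (hd _ hu.2.1) (hd _ hg.2.1),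
      _root_.sub_apply, hu.2.2 x hx, hg.2.2 x hx, sub_self])
  exact ⟨C, fun x hx => by linarith [hC x hx]⟩

end Uniqueness

end

end EEGGreen

theorem mainTheorem2 (n : ℕ) (hn : 1 ≤ n) (D : EuclideanSpace ℝ (Fin n)) :
    -- solution of the EEG problem, unique up to an additive function of `z`
    (∀ z ∈ ball (0 : EuclideanSpace ℝ (Fin n)) 1,
      ∀ u : EuclideanSpace ℝ (Fin n) → ℝ, EEGGreen.IsEEGSolution n D z u ↔
        ∃ C : ℝ, ∀ x ∈ closedBall (0 : EuclideanSpace ℝ (Fin n)) 1 \ {z},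
          u x = EEGGreen.eegGreen n D z x + C) ∧
    -- relation to the Green's function of the Neumann-Poisson problem
    (∀ z ∈ ball (0 : EuclideanSpace ℝ (Fin n)) 1,
      ∀ x ∈ closedBall (0 : EuclideanSpace ℝ (Fin n)) 1 \ {z},
        DifferentiableAt ℝ (fun w => EEGGreen.poissonGreen n w x) z ∧
        EEGGreen.eegGreen n D z x = -⟪D, (∇ (fun w => EEGGreen.poissonGreen n w x)) z⟫) ∧
    -- the second form of the formula
    (∀ z ∈ ball (0 : EuclideanSpace ℝ (Fin n)) 1, z ≠ 0 →
      ∀ x ∈ closedBall (0 : EuclideanSpace ℝ (Fin n)) 1 \ {z}, x ≠ 0 →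
        EEGGreen.eegGreen n D z x = EEGGreen.eegGreenAlt n D z x) ∧
    -- the value at `z = 0` is the limit of the formula as `z` tends to `0`
    (∀ x ∈ closedBall (0 : EuclideanSpace ℝ (Fin n)) 1 \ {0},
      Tendsto (fun z => EEGGreen.eegGreen n D z x) (𝓝[≠] 0)
        (𝓝 (EEGGreen.eegGreen n D 0 x))) := by
  refine ⟨fun z hz u => ⟨fun hu => hu.exists_eq_eegGreen_add hn hz, ?_⟩, fun z hz x hx => ?_,
    fun z hz hz0 x hx hx0 => ?_, fun x hx => EEGGreen.tendsto_eegGreen_zero D hx.2⟩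
  · rintro ⟨C, hC⟩
    exact EEGGreen.isEEGSolution_of_eq_eegGreen_add hn hz hC
  · exact EEGGreen.differentiableAt_poissonGreen_and_eegGreen_eq hn D hx.2
      (EEGGreen.norm_mul_norm_lt_one hx.1 hz)
  · exact EEGGreen.eegGreen_eq_eegGreenAlt D (EEGGreen.norm_mul_norm_lt_one hx.1 hz) hz0 hx0
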